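/- Let $(\ell_n)_{n\ge 1}$ be a decreasing (i.e. non-increasing) sequence of real numbers with $0<\ell_n<1$, and let $(\omega_n)_{n\ge1}$ be independent random variables uniformly distributed on the circle $\mathbb T=\mathbb R/\mathbb Z$ with its arc-length metric, defined on a probability space with probability $\Pr$. Let $B(x,r)$ be the open ball (arc) with centre $x$ and radius $r$, and put $$E_n=\bigcup_{k=1}^n B(\omega_k,\ell_n/2),\qquad \mathcal U(\omega)=\liminf_{n\to\infty}E_n=\bigcup_{N\ge1}\bigcap_{n\ge N}E_n .$$ 1) Let $\delta=\liminf_{n\to\infty}\frac{n\ell_n}{\ln n}\in[0,\infty]$ and assume $\delta<1$. Let $A\subset\mathbb T$ be a Borel (or, more generally, analytic) set with $\dim_{\mathrm H}A>\delta$, where $\dim_{\mathrm H}$ is the Hausdorff dimension. Then $\Pr(A\subset\mathcal U(\omega))=0$, and almost surely $\dim_{\mathrm H}(A\setminus\mathcal U(\omega))\ge\dim_{\mathrm H}A-\delta$. 2) Let $A\subset\mathbb T$ be any set and, for $r>0$, let $N(r)$ be the least number of closed balls of radius $r$ in $\mathbb T$ that cover $A$. Let $\beta\in\mathbb R$ be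 such that the upper box-counting dimension $\overline{\dim}_{\mathrm B}A=\limsup_{r\to0^+}\frac{\ln N(r)}{-\ln r}$ is at most $\beta$ (or such that $N(r)\le r^{-\beta}$ for all sufficiently small $r>0$). If for some $d\in(0,1)$ $$\sum_{n=1}^\infty\Big(\frac1{\ell_n}\Big)^{\beta}\exp(-n\,d\,\ell_n)<\infty,$$ then almost surely $A\subset\mathcal U(\omega)$. -/

import Mathlib

open MeasureTheory ProbabilityTheory Filter Topology
open scoped ENNReal NNReal

namespace UniformCovering

/-- The union `E_n` of the open arcs of length `ℓ n` centred at the first `n` points of the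
sequence `c` on the circle `ℝ/ℤ`. -/
def coveredAt (ℓ : ℕ+ → ℝ) (c : ℕ+ → UnitAddCircle) (n : ℕ+) : Set UnitAddCircle :=
  ⋃ k ≤ n, Metric.ball (c k) (ℓ n / 2)

/-- The set `liminf E_n` of the points that lie in `E_n` for all sufficiently large `n`. -/
def uniformlyCovered (ℓ : ℕ+ → ℝ) (c : ℕ+ → UnitAddCircle) : Set UnitAddCircle :=
  liminf (coveredAt ℓ c) atTop

/-- `liminf (n ℓ_n / ln n)`, with values in `[0, ∞]`. -/
noncomputable def lowerRate (ℓ : ℕ+ → ℝ) : ℝ≥0∞ :=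
  liminf (fun n : ℕ+ => ENNReal.ofReal ((n : ℝ) * ℓ n / Real.log (n : ℝ))) atTop

/-- The upper box-counting dimension `limsup_{r → 0+} log N(r) / (- log r)`, where `N(r)` is the
least number of balls of radius `r` that cover `A`. It is `-∞` for the empty set. -/
noncomputable def upperBoxDim {X : Type*} [PseudoEMetricSpace X] (A : Set X) : EReal :=
  limsup (fun r : ℝ≥0 =>
    ENNReal.log (Metric.externalCoveringNumber r A : ℝ≥0∞) / ((-Real.log (r : ℝ) : ℝ) : EReal))
    (𝓝[>] 0)

end UniformCovering

/-! Lower bound. Write `δ = lowerRate ℓ` and let `δ + s < t < dimH A`. Frostman's lemma for analytic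
sets gives a probability measure `μ` on a compact `K ⊆ A` with finite energies of all orders below
`t`. Choose sparse times `n j` at which `n * ℓ n` is nearly `δ * log n`, and give every index in `(n
(j-1), n j]` the arc length `ρ k = ℓ (n j)`. A point missed by all these arcs lies outside `E_n` for
every `n = n j`, hence outside the liminf. So it suffices to study the set left uncovered by fixed
arcs.

Restrict `μ` to the uncovered set by the normalized densities `gapProduct`. Two points farther apart
than `ρ` have correlation at most `1`. At smaller distance, stage `j` costs at most `(1 - ℓ (n j))⁻¹
^ n j ≤ ℓ (n j) ^ (-a) ≤ dist ^ (-a)`, for `a` slightly above `δ` (`frequently_inv_pow_le`). This is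
paid for by the energy of order `s + a < t` near the diagonal, which is tiny once `n j` is large.
Hence the second moment of the mass is at most `1 + ε` and the mean `s`-energy stays bounded
(`lintegral_prod_gapCorrelation_le`). By `measure_not_le_dimH_gap_le`, dimension `s` then survives
with probability at least `1 - 5ε`.

Covering. Cover `A` by balls of radius `κ * ℓ n` with `κ` small. A ball is not swallowed by one of
the first `n` arcs with probability at most `exp (-n d ℓ n)`; sum over the balls and apply
Borel–Cantelli. When only the box dimension is bounded, `exists_summable_of_summable` trades part of
the room between `d` and `1` for a larger exponent `β`. -/

namespace UniformCovering

/-! ### Contents of tree-like families of sets -/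

section Content

variable {X ι : Type*} (lev : ι → ℕ) (cell : ι → Set X) (w : ι → ℝ≥0∞)

/-- The cells of a tree: two cells with a common point are nested according to their levels. -/
def IsCellTree : Prop :=
  ∀ ⦃x p q⦄, x ∈ cell p → x ∈ cell q → lev p ≤ lev q →
    (lev p = lev q → p = q) ∧ cell q ⊆ cell p

/-- The least total weight of a family of cells that covers `E`. -/
noncomputable def content (E : Set X) : ℝ≥0∞ :=
  ⨅ (S : Set ι) (_ : E ⊆ ⋃ p ∈ S, cell p), ∑' p, S.indicator w p

/-- The members of a family of cells that lie in no member of smaller level. -/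
def topCells (S : Set ι) : Set ι :=
  {p ∈ S | ∀ q ∈ S, lev q < lev p → ¬ cell p ⊆ cell q}

variable {lev cell w}

lemma content_le {E : Set X} {S : Set ι} (h : E ⊆ ⋃ p ∈ S, cell p) :
    content cell w E ≤ ∑' p, S.indicator w p := iInf₂_le S h

lemma content_mono {E F : Set X} (h : E ⊆ F) : content cell w E ≤ content cell w F :=
  le_iInf₂ fun _ hS => content_le (h.trans hS)

lemma content_le_weight {E : Set X} {p : ι} (h : E ⊆ cell p) : content cell w E ≤ w p := by
  refine (content_le (S := {p}) (by simpa using h)).trans ?_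
  rw [← tsum_subtype, tsum_singleton]

lemma content_empty : content cell w ∅ = 0 := by
  refine le_antisymm ((content_le (S := ∅) (by simp)).trans ?_) zero_le
  simp

lemma content_union_le (E F : Set X) :
    content cell w (E ∪ F) ≤ content cell w E + content cell w F := by
  conv_rhs => rw [content, content]
  simp only [ENNReal.iInf_add, ENNReal.add_iInf]
  refine le_iInf₂ fun T hT => le_iInf₂ fun S hS => ?_
  refine (content_le (S := S ∪ T) ?_).trans ?_
  · rw [Set.biUnion_union]
    exact Set.union_subset_union hS hT
  · rw [← ENNReal.tsum_add]
    refine ENNReal.tsum_le_tsum fun p => ?_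
    by_cases h1 : p ∈ T <;> by_cases h2 : p ∈ S <;> simp [h1, h2]

lemma exists_topCells (S : Set ι) {x : X} (hx : x ∈ ⋃ p ∈ S, cell p) :
    ∃ p ∈ topCells lev cell S, x ∈ cell p := by
  simp only [Set.mem_iUnion, exists_prop] at hx
  obtain ⟨p, ⟨hpS, hxp⟩, hmin⟩ := exists_minimalFor_of_wellFoundedLT
    (fun p => p ∈ S ∧ x ∈ cell p) lev hx
  refine ⟨p, ⟨hpS, fun q hq hlt hsub => ?_⟩, hxp⟩
  exact absurd (hmin (j := q) ⟨hq, hsub hxp⟩ hlt.le) (not_le.2 hlt)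

/-- A form of strong subadditivity. The cells `V` that are counted twice in `W` and `S`, or dropped
when passing to `W'`, still cover `E`: of the two cells of `W` and `S` through a point, either they
coincide or the deeper one is dropped. -/
lemma tsum_topCells_add_content_le (htree : IsCellTree lev cell) {E : Set X} {T S : Set ι}
    (hT : E ⊆ ⋃ p ∈ T, cell p) (hS : E ⊆ ⋃ p ∈ S, cell p) :
    ∑' p, (topCells lev cell (T ∪ S)).indicator w p + content cell w E ≤
      ∑' p, (topCells lev cell T).indicator w p + ∑' p, S.indicator w p := by
  classical
  set W := topCells lev cell T with hW
  set W' := topCells lev cell (T ∪ S) with hW'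
  have hsub : W' ⊆ W ∪ S := by
    rintro p ⟨hp | hp, hp'⟩
    · exact Or.inl ⟨hp, fun q hq => hp' q (Or.inl hq)⟩
    · exact Or.inr hp
  set V : Set ι := (W ∩ S) ∪ ((W ∪ S) \ W') with hV
  have hcov : E ⊆ ⋃ p ∈ V, cell p := by
    intro x hx
    obtain ⟨p, hpW, hxp⟩ := exists_topCells (lev := lev) T (hT hx)
    have := hS hx
    simp only [Set.mem_iUnion, exists_prop] at this ⊢
    obtain ⟨q, hqS, hxq⟩ := this
    rcases lt_trichotomy (lev p) (lev q) with h | h | h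
    · exact ⟨q, Or.inr ⟨Or.inr hqS, fun hq => hq.2 p (Or.inl hpW.1) h (htree hxp hxq h.le).2⟩, hxq⟩
    · have := (htree hxp hxq h.le).1 h
      subst this
      exact ⟨p, Or.inl ⟨hpW, hqS⟩, hxp⟩
    · exact ⟨p, Or.inr ⟨Or.inl hpW, fun hp => hp.2 q (Or.inr hqS) h (htree hxq hxp h.le).2⟩, hxp⟩
  calc _ ≤ ∑' p, W'.indicator w p + ∑' p, V.indicator w p := by gcongr; exact content_le hcov
    _ = ∑' p, (W'.indicator w p + V.indicator w p) := ENNReal.tsum_add.symm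
    _ ≤ ∑' p, (W.indicator w p + S.indicator w p) := by
        refine ENNReal.tsum_le_tsum fun p => ?_
        have hp := @hsub p
        clear_value W W'
        by_cases h1 : p ∈ W <;> by_cases h2 : p ∈ S <;> by_cases h3 : p ∈ W' <;>
          simp_all [Set.indicator]
    _ = _ := ENNReal.tsum_add

/-- The content of the union of an increasing sequence of arbitrary sets is the limit of their
contents. -/
lemma content_iUnion_le (htree : IsCellTree lev cell) {E : ℕ → Set X} (hE : Monotone E) :
    content cell w (⋃ n, E n) ≤ ⨆ n, content cell w (E n) := by
  classical
  refine ENNReal.le_of_forall_pos_le_add fun ε hε hfin => ?_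
  obtain ⟨ε', hε'pos, hε'sum⟩ := ENNReal.exists_pos_sum_of_countable (ε := ε)
    (by exact_mod_cast hε.ne') ℕ
  have hne : ∀ n, content cell w (E n) ≠ ∞ := fun n =>
    ((le_iSup (fun n => content cell w (E n)) n).trans_lt hfin).ne
  have hex : ∀ n, ∃ S : Set ι, E n ⊆ ⋃ p ∈ S, cell p ∧
      ∑' p, S.indicator w p ≤ content cell w (E n) + ε' n := by
    intro n
    have : content cell w (E n) < content cell w (E n) + ε' n :=
      ENNReal.lt_add_right (hne n) (by exact_mod_cast (hε'pos n).ne')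
    conv_lhs at this => rw [content]
    simp only [iInf_lt_iff] at this
    obtain ⟨S, hS, h⟩ := this
    exact ⟨S, hS, h.le⟩
  choose S hScov hSsum using hex
  let T : ℕ → Set ι := fun N => ⋃ n ≤ N, S n
  have hTs : ∀ N, T (N + 1) = T N ∪ S (N + 1) := fun N => by
    ext p
    simp only [T, Set.mem_iUnion, Set.mem_union, exists_prop]
    constructor
    · rintro ⟨n, hn, hp⟩
      rcases hn.lt_or_eq with h | h
      · exact Or.inl ⟨n, by omega, hp⟩
      · exact Or.inr (h ▸ hp)
    · rintro (⟨n, hn, hp⟩ | hp)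
      · exact ⟨n, by omega, hp⟩
      · exact ⟨N + 1, le_rfl, hp⟩
  have hTcov : ∀ N, E N ⊆ ⋃ p ∈ T N, cell p := fun N =>
    (hScov N).trans (Set.biUnion_subset_biUnion_left fun p hp =>
      Set.mem_iUnion₂.2 ⟨N, le_rfl, hp⟩)
  -- Near-optimal covers are accumulated and only top cells are kept. Since `S (N + 1)` also covers
  -- `E N`, the preceding lemma lets the content of `E N` cancel, so the errors merely add up.
  have key : ∀ N, ∑' p, (topCells lev cell (T N)).indicator w p ≤
      content cell w (E N) + ∑ n ∈ Finset.range (N + 1), (ε' n : ℝ≥0∞) := by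
    intro N
    induction N with
    | zero =>
      have : topCells lev cell (T 0) ⊆ S 0 := by
        rintro p ⟨hp, -⟩
        simpa [T] using hp
      simpa using (ENNReal.tsum_le_tsum fun p =>
        Set.indicator_le_indicator_of_subset this (fun _ => zero_le) p).trans (hSsum 0)
    | succ N ih =>
      have h := tsum_topCells_add_content_le (w := w) htree (hTcov N)
        ((hE N.le_succ).trans (hScov (N + 1)))
      rw [← hTs] at h
      have h2 := h.trans (add_le_add ih (hSsum (N + 1)))
      rw [Finset.sum_range_succ]
      refine (ENNReal.add_le_add_iff_right (hne N)).1 (h2.trans (le_of_eq ?_))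
      ring
  have hcov : (⋃ n, E n) ⊆ ⋃ p ∈ topCells lev cell (⋃ n, S n), cell p := by
    intro x hx
    obtain ⟨n, hn⟩ := Set.mem_iUnion.1 hx
    have : x ∈ ⋃ p ∈ ⋃ n, S n, cell p := by
      obtain ⟨p, hp, hxp⟩ := Set.mem_iUnion₂.1 (hScov n hn)
      exact Set.mem_iUnion₂.2 ⟨p, Set.mem_iUnion.2 ⟨n, hp⟩, hxp⟩
    obtain ⟨p, hp, hxp⟩ := exists_topCells (lev := lev) _ this
    exact Set.mem_iUnion₂.2 ⟨p, hp, hxp⟩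
  refine (content_le hcov).trans ?_
  rw [ENNReal.tsum_eq_iSup_sum]
  refine iSup_le fun F => ?_
  -- A top cell of the whole union is a top cell of every `T N` that contains it, so a finite
  -- partial sum is controlled by a single `N`.
  have hev : ∀ᶠ N in atTop, ∀ p ∈ F, (topCells lev cell (⋃ n, S n)).indicator w p ≤
      (topCells lev cell (T N)).indicator w p := by
    rw [Filter.eventually_all_finset]
    intro p _
    by_cases hp : p ∈ topCells lev cell (⋃ n, S n)
    · obtain ⟨n, hn⟩ := Set.mem_iUnion.1 hp.1
      filter_upwards [eventually_ge_atTop n] with N hN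
      have : p ∈ topCells lev cell (T N) :=
        ⟨Set.mem_iUnion₂.2 ⟨n, hN, hn⟩, fun q hq => hp.2 q (by
          obtain ⟨k, -, hk⟩ := Set.mem_iUnion₂.1 hq
          exact Set.mem_iUnion.2 ⟨k, hk⟩)⟩
      simp [hp, this]
    · simp [hp]
  obtain ⟨N, hN⟩ := hev.exists
  calc _ ≤ ∑ p ∈ F, (topCells lev cell (T N)).indicator w p := Finset.sum_le_sum hN
    _ ≤ ∑' p, (topCells lev cell (T N)).indicator w p := ENNReal.sum_le_tsum F
    _ ≤ _ := key N
    _ ≤ _ := add_le_add (le_iSup (fun n => content cell w (E n)) N)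
      ((ENNReal.sum_le_tsum _).trans hε'sum.le)

end Content

/-! ### Capacitability of analytic sets -/

/-- An analytic set is approximated from inside by compact sets with respect to every monotone set
function that is continuous along increasing sequences. -/
lemma exists_isCompact_forall_isOpen_lt {X : Type*} [TopologicalSpace X] {c : Set X → ℝ≥0∞}
    (hmono : Monotone c) (hcont : ∀ E : ℕ → Set X, Monotone E → c (⋃ n, E n) ≤ ⨆ n, c (E n))
    {A : Set X} (hA : AnalyticSet A) {a : ℝ≥0∞} (ha : a < c A) :
    ∃ K ⊆ A, IsCompact K ∧ ∀ U, IsOpen U → K ⊆ U → a < c U := by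
  classical
  rw [AnalyticSet] at hA
  rcases hA with rfl | ⟨f, hf, rfl⟩
  · exact ⟨∅, le_rfl, isCompact_empty, fun U _ _ => ha.trans_le (hmono (Set.empty_subset U))⟩
  let C : ℕ → (ℕ → ℕ) → Set (ℕ → ℕ) := fun k m => {x | ∀ i < k, x i ≤ m i}
  have hstep : ∀ k m, a < c (f '' C k m) → ∃ b, a < c (f '' (C k m ∩ {x | x k ≤ b})) := by
    intro k m h
    have h1 : f '' C k m = ⋃ b, f '' (C k m ∩ {x | x k ≤ b}) := by
      rw [← Set.image_iUnion, ← Set.inter_iUnion]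
      congr 1
      ext x
      simp only [Set.mem_inter_iff, Set.mem_iUnion, Set.mem_ofPred_eq, iff_self_and]
      exact fun _ => ⟨x k, le_rfl⟩
    rw [h1] at h
    have h2 := h.trans_le (hcont _ fun b b' hb => Set.image_mono
      (Set.inter_subset_inter_right _ fun x (hx : x k ≤ b) => hx.trans hb))
    exact lt_iSup_iff.1 h2
  have hseq : ∃ m : ℕ → ℕ, ∀ k, a < c (f '' C k m) := by
    -- Coordinates are bounded one at a time, keeping the value above `a`; the default `0` is never
    -- used.
    let st : ℕ → Set (ℕ → ℕ) → ℕ := fun k D =>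
      if h : ∃ b, a < c (f '' (D ∩ {x | x k ≤ b})) then h.choose else 0
    let D : ℕ → Set (ℕ → ℕ) := fun k => Nat.rec Set.univ (fun k D => D ∩ {x | x k ≤ st k D}) k
    have hD : ∀ k, D k = C k (fun i => st i (D i)) := by
      intro k
      induction k with
      | zero => ext x; simp [D, C]
      | succ k ih =>
        have : D (k + 1) = D k ∩ {x | x k ≤ st k (D k)} := rfl
        rw [this]
        ext x
        constructor
        · rintro ⟨h1, h2⟩ i hi
          rw [ih] at h1
          rcases Nat.lt_succ_iff_lt_or_eq.1 hi with h | rfl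
          · exact h1 i h
          · exact h2
        · intro h
          refine ⟨?_, h k (by omega)⟩
          rw [ih]
          exact fun i hi => h i (by omega)
    refine ⟨fun i => st i (D i), fun k => ?_⟩
    induction k with
    | zero => simpa [C, Set.image_univ] using ha
    | succ k ih =>
      rw [← hD]
      have hex : ∃ b, a < c (f '' (D k ∩ {x | x k ≤ b})) := by
        rw [hD k]
        exact hstep _ _ ih
      have : D (k + 1) = D k ∩ {x | x k ≤ st k (D k)} := rfl
      rw [this]
      simp only [st, dif_pos hex]
      exact hex.choose_spec
  obtain ⟨m, hm⟩ := hseq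
  have hcomp : IsCompact (Set.univ.pi fun i => Set.Iic (m i)) :=
    isCompact_univ_pi fun i => (Set.finite_Iic (m i)).isCompact
  refine ⟨f '' Set.univ.pi fun i => Set.Iic (m i), Set.image_subset_range _ _, hcomp.image hf,
    fun U hU hKU => ?_⟩
  let := PiNat.metricSpaceNatNat
  obtain ⟨ε, hε, hsub⟩ := hcomp.exists_thickening_subset_open (hU.preimage hf)
    (Set.image_subset_iff.1 hKU)
  obtain ⟨k, hk⟩ := exists_pow_lt_of_lt_one hε (by norm_num : (1 / 2 : ℝ) < 1)
  -- Truncating a point of `C k m` at `m` lands in the compact box and changes only coordinates from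
  -- `k` on. So `C k m` lies in the thickening, whatever its unbounded coordinates.
  refine (hm k).trans_le (hmono ?_)
  rintro _ ⟨y, hy, rfl⟩
  refine hsub (Metric.mem_thickening_iff.2 ⟨fun i => min (y i) (m i),
    fun i _ => min_le_right (y i) (m i), ?_⟩)
  refine lt_of_le_of_lt ?_ hk
  rw [← PiNat.mem_cylinder_iff_dist_le, PiNat.mem_cylinder_iff]
  intro i hi
  exact (min_eq_left (hy i hi)).symm

/-! ### Dyadic intervals and Frostman measures -/

/-- The dyadic interval `[j 2⁻ᵏ, (j + 1) 2⁻ᵏ)` of the real line, where `p = (k, j)`. -/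
def dyadicCell (p : ℕ × ℤ) : Set ℝ := {x | ⌊(2 : ℝ) ^ p.1 * x⌋ = p.2}

/-- The weight `2⁻ᵏˢ` of a dyadic interval of length `2⁻ᵏ`. -/
noncomputable def dyadicWeight (s : ℝ) (p : ℕ × ℤ) : ℝ≥0∞ := 2 ^ (-(s * p.1))

lemma isCellTree_dyadicCell : IsCellTree Prod.fst dyadicCell := by
  intro x p q hp hq hle
  have key : ∀ y, ⌊(2 : ℝ) ^ p.1 * y⌋ = ⌊(2 : ℝ) ^ q.1 * y⌋ / ((2 ^ (q.1 - p.1) : ℕ) : ℤ) := by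
    intro y
    rw [← Int.floor_div_natCast]
    congr 1
    push_cast
    rw [eq_div_iff (by positivity), mul_right_comm, ← pow_add, Nat.add_sub_cancel' hle]
  simp only [dyadicCell, Set.mem_ofPred_eq] at hp hq
  refine ⟨fun h => Prod.ext h ?_, fun y hy => ?_⟩
  · rw [← hp, ← hq, h]
  · simp only [dyadicCell, Set.mem_ofPred_eq] at hy ⊢
    rw [key, hy, ← hq, ← key, hp]

lemma measurableSet_dyadicCell (p : ℕ × ℤ) : MeasurableSet (dyadicCell p) :=
  (Int.measurable_floor.comp (measurable_const_mul _)) (measurableSet_singleton p.2)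

lemma ediam_dyadicCell_le (p : ℕ × ℤ) : Metric.ediam (dyadicCell p) ≤ 2 ^ (-(p.1 : ℝ)) := by
  refine Metric.ediam_le fun x hx y hy => ?_
  have h := Int.abs_sub_lt_one_of_floor_eq_floor (hx.trans hy.symm)
  rw [← mul_sub, abs_mul, abs_of_pos (by positivity)] at h
  have h2 : |x - y| ≤ 2 ^ (-(p.1 : ℝ)) := by
    rw [Real.rpow_neg (by norm_num), Real.rpow_natCast, ← one_div, le_div_iff₀' (by positivity)]
    exact h.le
  rw [edist_dist, Real.dist_eq]
  refine (ENNReal.ofReal_le_ofReal h2).trans (le_of_eq ?_)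
  rw [← ENNReal.ofReal_rpow_of_pos (by norm_num)]
  norm_num

lemma ediam_dyadicCell_rpow_le {s : ℝ} (hs : 0 ≤ s) (p : ℕ × ℤ) :
    Metric.ediam (dyadicCell p) ^ s ≤ dyadicWeight s p := by
  refine (ENNReal.rpow_le_rpow (ediam_dyadicCell_le p) hs).trans (le_of_eq ?_)
  rw [dyadicWeight, ← ENNReal.rpow_mul]
  ring_nf

lemma dyadicWeight_le_of_le {s : ℝ} (hs : 0 ≤ s) {p q : ℕ × ℤ} (h : p.1 ≤ q.1) :
    dyadicWeight s q ≤ dyadicWeight s p := by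
  refine ENNReal.rpow_le_rpow_of_exponent_le (by norm_num) ?_
  have : (p.1 : ℝ) ≤ q.1 := by exact_mod_cast h
  nlinarith

lemma dyadicWeight_ne_top (s : ℝ) (p : ℕ × ℤ) : dyadicWeight s p ≠ ∞ :=
  ENNReal.rpow_ne_top_of_ne_zero (by norm_num) (by norm_num)

/-- The content does not restrict the size of the cells, but for `s > 0` a small total weight forces
every cell used to have small diameter, so cheap covers are automatically fine. -/
lemma hausdorffMeasure_eq_zero_of_content_eq_zero {s : ℝ} (hs : 0 < s) {E : Set ℝ}
    (hE : content dyadicCell (dyadicWeight s) E = 0) : μH[s] E = 0 := by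
  have hex : ∀ n : ℕ, ∃ S : Set (ℕ × ℤ), E ⊆ ⋃ p ∈ S, dyadicCell p ∧
      ∑' p, S.indicator (dyadicWeight s) p ≤ ((n : ℝ≥0∞))⁻¹ := by
    intro n
    have : content dyadicCell (dyadicWeight s) E < (n : ℝ≥0∞)⁻¹ := by
      rw [hE]
      exact ENNReal.inv_pos.2 (ENNReal.natCast_ne_top n)
    rw [content] at this
    simp only [iInf_lt_iff] at this
    obtain ⟨S, hS, h⟩ := this
    exact ⟨S, hS, h.le⟩
  choose S hS hsum using hex
  have hle : ∀ n (p : S n), dyadicWeight s p ≤ ((n : ℝ≥0∞))⁻¹ := fun n p => by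
    refine le_trans ?_ (hsum n)
    rw [← tsum_subtype]
    exact ENNReal.le_tsum (f := fun p : S n => dyadicWeight s p) p
  have hsum' : ∀ n, ∑' p : S n, Metric.ediam (dyadicCell p) ^ s ≤ (n : ℝ≥0∞)⁻¹ := fun n =>
    calc ∑' p : S n, Metric.ediam (dyadicCell p) ^ s
        ≤ ∑' p : S n, dyadicWeight s p :=
          ENNReal.tsum_le_tsum fun p => ediam_dyadicCell_rpow_le hs.le p.1
      _ = ∑' p, (S n).indicator (dyadicWeight s) p := tsum_subtype (S n) (dyadicWeight s)
      _ ≤ (n : ℝ≥0∞)⁻¹ := hsum n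
  have h := Measure.hausdorffMeasure_le_liminf_tsum (β := ℕ) (ι := fun n => S n) s E (l := atTop)
    (fun n => ((n : ℝ≥0∞)⁻¹) ^ (1 / s)) ?_ (fun n p => dyadicCell p) ?_ ?_
  · refine le_antisymm (h.trans ?_) zero_le
    exact (liminf_le_liminf (v := fun n : ℕ => (n : ℝ≥0∞)⁻¹) (Eventually.of_forall hsum')).trans
      (ENNReal.tendsto_inv_nat_nhds_zero.liminf_eq).le
  · have := (ENNReal.continuous_rpow_const (y := 1 / s)).tendsto 0
    rw [ENNReal.zero_rpow_of_pos (by positivity)] at this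
    exact this.comp ENNReal.tendsto_inv_nat_nhds_zero
  · refine Eventually.of_forall fun n p => ?_
    have := (ediam_dyadicCell_rpow_le hs.le p.1).trans (hle n p)
    rwa [one_div, ENNReal.le_rpow_inv_iff hs]
  · refine Eventually.of_forall fun n => ?_
    simpa [Set.iUnion_subtype] using hS n

/-- Cells are half-open, so a cover by cells need not contain a neighbourhood. Adding the left
neighbour of each cell makes room for an open set and doubles the cost. -/
lemma le_two_mul_content {s : ℝ} {K : Set ℝ} {a : ℝ≥0∞}
    (h : ∀ U, IsOpen U → K ⊆ U → a < content dyadicCell (dyadicWeight s) U) :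
    a ≤ 2 * content dyadicCell (dyadicWeight s) K := by
  conv_rhs => rw [content]
  rw [ENNReal.mul_iInf_of_ne (by norm_num) (by norm_num)]
  simp_rw [ENNReal.mul_iInf_of_ne (a := 2) (by norm_num) (by norm_num)]
  refine le_iInf₂ fun S hS => ?_
  let e : ℕ × ℤ ≃ ℕ × ℤ := Equiv.prodCongr (Equiv.refl _) (Equiv.addRight 1)
  have hsum : ∑' p, (e ⁻¹' S).indicator (dyadicWeight s) p =
      ∑' p, S.indicator (dyadicWeight s) p := by
    rw [← e.tsum_eq (S.indicator (dyadicWeight s))]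
    rfl
  have hopen : IsOpen (⋃ p ∈ S, {x : ℝ | |(2 : ℝ) ^ p.1 * x - p.2| < 1}) :=
    isOpen_biUnion fun p _ => isOpen_lt (by fun_prop) continuous_const
  refine (h _ hopen fun x hx => ?_).le.trans ?_
  · obtain ⟨p, hp, hxp⟩ := Set.mem_iUnion₂.1 (hS hx)
    refine Set.mem_iUnion₂.2 ⟨p, hp, ?_⟩
    simp only [dyadicCell, Set.mem_ofPred_eq, Int.floor_eq_iff] at hxp ⊢
    rw [abs_lt]
    constructor <;> linarith
  · refine (content_le (S := S ∪ e ⁻¹' S) fun x hx => ?_).trans (le_trans (b := ∑' p,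
      (S.indicator (dyadicWeight s) p + (e ⁻¹' S).indicator (dyadicWeight s) p)) ?_ ?_)
    · obtain ⟨p, hp, hxp⟩ := Set.mem_iUnion₂.1 hx
      simp only [Set.mem_ofPred_eq, abs_lt] at hxp
      by_cases h0 : (p.2 : ℝ) ≤ 2 ^ p.1 * x
      · refine Set.mem_iUnion₂.2 ⟨p, Or.inl hp, ?_⟩
        simp only [dyadicCell, Set.mem_ofPred_eq, Int.floor_eq_iff]
        constructor <;> linarith
      · refine Set.mem_iUnion₂.2 ⟨(p.1, p.2 - 1), Or.inr (by simpa [e] using hp), ?_⟩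
        simp only [dyadicCell, Set.mem_ofPred_eq, Int.floor_eq_iff]
        push_cast
        constructor <;> linarith
    · refine ENNReal.tsum_le_tsum fun p => ?_
      by_cases h1 : p ∈ S <;> by_cases h2 : p ∈ e ⁻¹' S <;> simp [h1, h2, -Set.mem_preimage]
    · rw [ENNReal.tsum_add, hsum, two_mul]

lemma dyadicCell_eq_union (p : ℕ × ℤ) :
    dyadicCell p = dyadicCell (p.1 + 1, 2 * p.2) ∪ dyadicCell (p.1 + 1, 2 * p.2 + 1) := by
  ext x
  simp only [dyadicCell, Set.mem_ofPred_eq, Int.floor_eq_iff, Set.mem_union, pow_succ]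
  push_cast
  constructor
  · rintro ⟨h1, h2⟩
    by_cases h : 2 ^ p.1 * 2 * x < 2 * (p.2 : ℝ) + 1
    · exact Or.inl ⟨by linarith, h⟩
    · exact Or.inr ⟨by linarith, by linarith⟩
  · rintro (⟨h1, h2⟩ | ⟨h1, h2⟩) <;> constructor <;> linarith

/-- A discrete measure on `K` that satisfies the Frostman condition on the dyadic intervals up to a
given level. -/
lemma exists_measure_dyadicCell_le {s : ℝ} (hs : 0 ≤ s) {K : Set ℝ} (hK : MeasurableSet K)
    (d : ℕ) (p : ℕ × ℤ) :
    ∃ ν : Measure ℝ, content dyadicCell (dyadicWeight s) (K ∩ dyadicCell p) ≤ ν Set.univ ∧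
      ν Set.univ ≤ dyadicWeight s p ∧ ν (K ∩ dyadicCell p)ᶜ = 0 ∧
      ∀ q : ℕ × ℤ, p.1 ≤ q.1 → q.1 ≤ p.1 + d → ν (dyadicCell q) ≤ dyadicWeight s q := by
  induction d generalizing p with
  | zero =>
    rcases (K ∩ dyadicCell p).eq_empty_or_nonempty with he | ⟨x, hx⟩
    · exact ⟨0, by simp [he, content_empty]⟩
    · have huniv : (dyadicWeight s p • Measure.dirac x) Set.univ = dyadicWeight s p := by simp
      refine ⟨dyadicWeight s p • Measure.dirac x, ?_, huniv.le, ?_, fun q h1 h2 => ?_⟩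
      · rw [huniv]
        exact content_le_weight Set.inter_subset_right
      · rw [Measure.smul_apply, Measure.dirac_apply' _
          (hK.inter (measurableSet_dyadicCell p)).compl]
        simp [hx.1, hx.2]
      · exact (measure_mono (Set.subset_univ _)).trans
          (huniv.le.trans (dyadicWeight_le_of_le hs (by omega)))
  | succ d ih =>
    obtain ⟨ν₀, hc₀, hw₀, hn₀, hq₀⟩ := ih (p.1 + 1, 2 * p.2)
    obtain ⟨ν₁, hc₁, hw₁, hn₁, hq₁⟩ := ih (p.1 + 1, 2 * p.2 + 1)
    have hsplit := dyadicCell_eq_union p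
    have hcont : content dyadicCell (dyadicWeight s) (K ∩ dyadicCell p) ≤
        (ν₀ + ν₁) Set.univ := by
      rw [hsplit, Set.inter_union_distrib_left, Measure.add_apply]
      exact (content_union_le _ _).trans (add_le_add hc₀ hc₁)
    have hnull : (ν₀ + ν₁) (K ∩ dyadicCell p)ᶜ = 0 := by
      rw [Measure.add_apply, add_eq_zero]
      constructor
      · refine measure_mono_null (Set.compl_subset_compl.2 ?_) hn₀
        rw [hsplit]
        exact Set.inter_subset_inter_right _ Set.subset_union_left
      · refine measure_mono_null (Set.compl_subset_compl.2 ?_) hn₁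
        rw [hsplit]
        exact Set.inter_subset_inter_right _ Set.subset_union_right
    have hfin : (ν₀ + ν₁) Set.univ ≠ ∞ := by
      rw [Measure.add_apply]
      exact ENNReal.add_ne_top.2 ⟨(hw₀.trans_lt (dyadicWeight_ne_top s _).lt_top).ne,
        (hw₁.trans_lt (dyadicWeight_ne_top s _).lt_top).ne⟩
    have hdisj : ∀ (r r' q : ℕ × ℤ) (ν : Measure ℝ), r.1 = r'.1 → r ≠ r' → r.1 ≤ q.1 →
        ν (K ∩ dyadicCell r)ᶜ = 0 → ν (dyadicCell q) ≠ 0 → dyadicCell q ⊆ (dyadicCell r')ᶜ := by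
      intro r r' q ν h1 hne hle hν hq y hy hy'
      have hsub := (isCellTree_dyadicCell hy' hy (h1 ▸ hle)).2
      refine hq (measure_mono_null (t := (K ∩ dyadicCell r)ᶜ) (fun z hz hzr => hne ?_) hν)
      exact (isCellTree_dyadicCell hzr.2 (hsub hz) h1.le).1 h1
    have hqsum : ∀ q : ℕ × ℤ, p.1 + 1 ≤ q.1 → q.1 ≤ p.1 + (d + 1) →
        (ν₀ + ν₁) (dyadicCell q) ≤ dyadicWeight s q := by
      intro q h1 h2
      rw [Measure.add_apply]
      by_cases h0 : ν₀ (dyadicCell q) = 0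
      · rw [h0, zero_add]
        exact hq₁ q h1 (by simp only; omega)
      · have : ν₁ (dyadicCell q) = 0 := by
          refine measure_mono_null ?_ hn₁
          refine (hdisj (p.1 + 1, 2 * p.2) (p.1 + 1, 2 * p.2 + 1) q ν₀ rfl (by simp) h1 hn₀
            h0).trans (Set.compl_subset_compl.2 Set.inter_subset_right)
        rw [this, add_zero]
        exact hq₀ q h1 (by simp only; omega)
    by_cases hle : (ν₀ + ν₁) Set.univ ≤ dyadicWeight s p
    · refine ⟨ν₀ + ν₁, hcont, hle, hnull, fun q h1 h2 => ?_⟩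
      rcases h1.lt_or_eq with h | h
      · exact hqsum q h h2
      · exact (measure_mono (Set.subset_univ _)).trans
          (hle.trans (dyadicWeight_le_of_le hs h.ge))
    · rw [not_le] at hle
      -- If the two halves together are too heavy, scale to mass exactly the weight of `p`; this
      -- still dominates the content, since `p` alone is a cover.
      set c : ℝ≥0∞ := dyadicWeight s p / (ν₀ + ν₁) Set.univ with hc
      have hc1 : c ≤ 1 := ENNReal.div_le_of_le_mul (by rw [one_mul]; exact hle.le)
      have huniv : (c • (ν₀ + ν₁)) Set.univ = dyadicWeight s p := by
        rw [Measure.smul_apply, smul_eq_mul, hc, ENNReal.div_mul_cancel (pos_of_gt hle).ne' hfin]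
      refine ⟨c • (ν₀ + ν₁), ?_, huniv.le, ?_, fun q h1 h2 => ?_⟩
      · rw [huniv]
        exact content_le_weight Set.inter_subset_right
      · rw [Measure.smul_apply, hnull, smul_zero]
      · rcases h1.lt_or_eq with h | h
        · refine le_trans ?_ (hqsum q h h2)
          rw [Measure.smul_apply, smul_eq_mul]
          exact mul_le_of_le_one_left zero_le hc1
        · exact (measure_mono (Set.subset_univ _)).trans
            (huniv.le.trans (dyadicWeight_le_of_le hs h.ge))

/-! ### Transfer of Frostman measures from the line to the circle. -/

lemma lipschitzWith_coe_unitAddCircle : LipschitzWith 1 ((↑) : ℝ → UnitAddCircle) := by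
  refine LipschitzWith.of_dist_le_mul fun x y => ?_
  rw [dist_eq_norm, ← AddCircle.coe_sub, NNReal.coe_one, one_mul, Real.dist_eq, UnitAddCircle.norm_eq]
  simpa using round_le (x - y) 0

lemma mem_dyadicCell_zero {x : ℝ} : x ∈ dyadicCell (0, 0) ↔ x ∈ Set.Ico (0 : ℝ) 1 := by
  simp [dyadicCell, Int.floor_eq_iff]

/-- A ball of radius `2⁻ᵏ` of the circle is covered by nine dyadic intervals of length `2⁻ᵏ`. -/
lemma exists_finset_dyadicCell_cover_ball (x : UnitAddCircle) (k : ℕ) :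
    ∃ J : Finset ℤ, J.card ≤ 9 ∧ ((↑) : ℝ → UnitAddCircle) ⁻¹' Metric.ball x ((1 / 2) ^ k) ∩
      dyadicCell (0, 0) ⊆ ⋃ j ∈ J, dyadicCell (k, j) := by
  obtain ⟨x₀, hx₀, rfl⟩ : ∃ x₀ ∈ Set.Ico (0 : ℝ) 1, (x₀ : UnitAddCircle) = x := by
    have := AddCircle.coe_image_Ico_eq (1 : ℝ) 0
    have hx : x ∈ ((↑) : ℝ → UnitAddCircle) '' Set.Ico 0 (0 + 1) := by rw [this]; trivial
    simpa using hx
  -- `t.1` is the integer `round (y - x₀)` realizing the distance on the circle, `t.2` the remaining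
  -- difference of the floors; each takes three values.
  refine ⟨(Finset.Icc (-1 : ℤ) 1 ×ˢ Finset.Icc (-1 : ℤ) 1).image
    fun t => ⌊(2 : ℝ) ^ k * x₀⌋ + t.1 * 2 ^ k + t.2, ?_, ?_⟩
  · exact Finset.card_image_le.trans (by decide)
  · rintro y ⟨hy, hy0⟩
    rw [mem_dyadicCell_zero] at hy0
    rw [Set.mem_preimage, Metric.mem_ball, dist_eq_norm, ← AddCircle.coe_sub,
      UnitAddCircle.norm_eq] at hy
    set n : ℤ := round (y - x₀) with hn
    have hn1 := abs_le.1 (abs_sub_round (y - x₀))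
    rw [← hn] at hn1
    have h2k : (0 : ℝ) < 2 ^ k := by positivity
    have hfl : |(2 : ℝ) ^ k * y - 2 ^ k * x₀ - n * 2 ^ k| < 1 := by
      have : (2 : ℝ) ^ k * y - 2 ^ k * x₀ - n * 2 ^ k = 2 ^ k * (y - x₀ - n) := by ring
      rw [this, abs_mul, abs_of_pos h2k, ← lt_div_iff₀' h2k]
      simpa using hy
    rw [abs_lt] at hfl
    have hr1 : (-2 : ℝ) < n := by linarith [hy0.1, hx₀.2, hn1.2]
    have hr2 : (n : ℝ) < 2 := by linarith [hy0.2, hx₀.1, hn1.1]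
    have hr1' : (-2 : ℤ) < n := by exact_mod_cast hr1
    have hr2' : n < (2 : ℤ) := by exact_mod_cast hr2
    have f1 := Int.floor_le ((2 : ℝ) ^ k * y)
    have f2 := Int.lt_floor_add_one ((2 : ℝ) ^ k * y)
    have f3 := Int.floor_le ((2 : ℝ) ^ k * x₀)
    have f4 := Int.lt_floor_add_one ((2 : ℝ) ^ k * x₀)
    have hi1 : ((-2 : ℤ) : ℝ) < (⌊(2 : ℝ) ^ k * y⌋ - ⌊(2 : ℝ) ^ k * x₀⌋ - n * 2 ^ k : ℤ) := by
      push_cast; linarith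
    have hi2 : ((⌊(2 : ℝ) ^ k * y⌋ - ⌊(2 : ℝ) ^ k * x₀⌋ - n * 2 ^ k : ℤ) : ℝ) < (2 : ℤ) := by
      push_cast; linarith
    have hi1' := Int.cast_lt.1 hi1
    have hi2' := Int.cast_lt.1 hi2
    refine Set.mem_iUnion₂.2 ⟨⌊(2 : ℝ) ^ k * y⌋, Finset.mem_image.2
      ⟨(n, ⌊(2 : ℝ) ^ k * y⌋ - ⌊(2 : ℝ) ^ k * x₀⌋ - n * 2 ^ k), ?_, by ring⟩, rfl⟩
    rw [Finset.mem_product, Finset.mem_Icc, Finset.mem_Icc]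
    refine ⟨⟨by simp only; omega, by simp only; omega⟩, by simp only; omega, by simp only; omega⟩

/-- **Frostman lemma** for analytic subsets of the circle. -/
theorem exists_frostman_measure {A : Set UnitAddCircle} (hA : AnalyticSet A) {s : ℝ≥0}
    (hs : 0 < s) (h : (s : ℝ≥0∞) < dimH A) :
    ∃ K ⊆ A, IsCompact K ∧ ∃ (μ : Measure UnitAddCircle) (C : ℝ≥0∞), IsProbabilityMeasure μ ∧
      C ≠ ∞ ∧ μ Kᶜ = 0 ∧ ∀ x (k : ℕ), μ (Metric.ball x ((1 / 2) ^ k)) ≤ C * 2 ^ (-(s * k : ℝ)) := by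
  set φ : ℝ → UnitAddCircle := (↑) with hφ
  have hφc : Continuous φ := lipschitzWith_coe_unitAddCircle.continuous
  set A' : Set ℝ := φ ⁻¹' A ∩ Set.Ico 0 1 with hA'
  have hA'an : AnalyticSet A' := by
    rw [hA', Set.inter_eq_iInter]
    refine AnalyticSet.iInter fun b => ?_
    cases b
    · exact measurableSet_Ico.analyticSet
    · exact hA.preimage hφc
  have himg : A ⊆ φ '' A' := by
    intro x hx
    have hx' : x ∈ φ '' Set.Ico 0 (0 + 1) := by
      rw [hφ, AddCircle.coe_image_Ico_eq (1 : ℝ) 0]; trivial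
    obtain ⟨y, hy, rfl⟩ := hx'
    exact ⟨y, ⟨hx, by simpa using hy⟩, rfl⟩
  have hdim : (s : ℝ≥0∞) < dimH A' :=
    h.trans_le ((dimH_mono himg).trans (lipschitzWith_coe_unitAddCircle.dimH_image_le A'))
  set c : Set ℝ → ℝ≥0∞ := content dyadicCell (dyadicWeight s) with hc
  have hpos : c A' ≠ 0 := fun h0 => by
    have h1 := hausdorffMeasure_eq_zero_of_content_eq_zero (by exact_mod_cast hs) h0
    rw [hausdorffMeasure_of_lt_dimH hdim] at h1
    exact ENNReal.top_ne_zero h1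
  obtain ⟨a, ha0, ha⟩ := exists_between (pos_iff_ne_zero.2 hpos)
  obtain ⟨K', hK'A, hK', hU⟩ := exists_isCompact_forall_isOpen_lt
    (fun _ _ => content_mono) (fun E hE => content_iUnion_le isCellTree_dyadicCell hE) hA'an ha
  have hcK : c K' ≠ 0 := fun h0 => by
    have := le_two_mul_content hU
    rw [← hc, h0, mul_zero] at this
    exact ha0.ne' (le_antisymm this zero_le)
  have hK'cell : K' ∩ dyadicCell (0, 0) = K' := Set.inter_eq_left.2 fun x hx =>
    mem_dyadicCell_zero.2 (hK'A hx).2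
  have hex := fun m => exists_measure_dyadicCell_le (s := s) s.2 hK'.measurableSet m (0, 0)
  rw [hK'cell] at hex
  choose ν hν1 hν2 hν3 hν4 using hex
  have hν0 : ∀ m, ν m Set.univ ≠ 0 := fun m h0 => hcK (le_antisymm (h0 ▸ hν1 m) zero_le)
  have hνtop : ∀ m, ν m Set.univ ≠ ∞ := fun m =>
    ((hν2 m).trans_lt (dyadicWeight_ne_top _ _).lt_top).ne
  have hprob : ∀ m, IsProbabilityMeasure (((ν m Set.univ)⁻¹ • ν m).map φ) := fun m => by
    refine ⟨?_⟩
    rw [Measure.map_apply hφc.measurable MeasurableSet.univ, Set.preimage_univ, Measure.smul_apply,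
      smul_eq_mul, ENNReal.inv_mul_cancel (hν0 m) (hνtop m)]
  let P : ℕ → ProbabilityMeasure UnitAddCircle := fun m => ⟨_, hprob m⟩
  have hPapply : ∀ m (V : Set UnitAddCircle), IsOpen V →
      (P m : Measure UnitAddCircle) V ≤ (c K')⁻¹ * ν m (φ ⁻¹' V) := fun m V hV => by
    change (((ν m Set.univ)⁻¹ • ν m).map φ) V ≤ _
    rw [Measure.map_apply hφc.measurable hV.measurableSet, Measure.smul_apply, smul_eq_mul]
    gcongr
    exact hν1 m
  -- A weak limit along an ultrafilter exists by compactness. Both required bounds concern open sets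
  -- (`Kᶜ` and balls), whose mass does not jump up in the limit.
  obtain ⟨μ, -, hμ⟩ := isCompact_univ.ultrafilter_le_nhds
    ((hyperfilter ℕ).map P) (by simp)
  have hlim : Tendsto P (hyperfilter ℕ : Filter ℕ) (𝓝 μ) := hμ
  have hKc : IsCompact (φ '' K') := hK'.image hφc
  refine ⟨φ '' K', Set.image_subset_iff.2 fun x hx => (hK'A hx).1, hKc, μ, (c K')⁻¹ * 9,
    inferInstance, ENNReal.mul_ne_top (ENNReal.inv_ne_top.2 hcK) (by norm_num), ?_, fun x k => ?_⟩
  · have hle := ProbabilityMeasure.le_liminf_measure_open_of_tendsto hlim hKc.isClosed.isOpen_compl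
    refine le_antisymm (hle.trans ?_) zero_le
    have : ∀ m, (P m : Measure UnitAddCircle) (φ '' K')ᶜ = 0 := fun m => by
      refine le_antisymm ((hPapply m _ hKc.isClosed.isOpen_compl).trans ?_) zero_le
      have hsub : φ ⁻¹' (φ '' K')ᶜ ⊆ K'ᶜ := fun y hy hyK => hy (Set.mem_image_of_mem φ hyK)
      rw [measure_mono_null hsub (hν3 m), mul_zero]
    simp [this]
  · have hle := ProbabilityMeasure.le_liminf_measure_open_of_tendsto hlim
      (Metric.isOpen_ball (x := x) (ε := (1 / 2) ^ k))
    refine hle.trans ?_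
    refine Filter.liminf_le_of_frequently_le' (Eventually.frequently ?_)
    have hge : ∀ᶠ m in (hyperfilter ℕ : Filter ℕ), k ≤ m :=
      Nat.hyperfilter_le_atTop (eventually_ge_atTop k)
    filter_upwards [hge] with m hm
    refine (hPapply m _ Metric.isOpen_ball).trans ?_
    rw [mul_assoc]
    gcongr
    obtain ⟨J, hJ, hcov⟩ := exists_finset_dyadicCell_cover_ball x k
    have hae : ν m (φ ⁻¹' Metric.ball x ((1 / 2) ^ k)) ≤
        ν m (⋃ j ∈ J, dyadicCell (k, j)) := by
      refine measure_mono_ae ?_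
      have : ∀ᵐ y ∂(ν m), y ∈ K' := hν3 m
      filter_upwards [this] with y hy hyb
      exact hcov ⟨hyb, mem_dyadicCell_zero.2 (hK'A hy).2⟩
    refine hae.trans ((measure_biUnion_finset_le _ _).trans ?_)
    refine (Finset.sum_le_card_nsmul _ _ (dyadicWeight s (k, 0)) fun j _ =>
      hν4 m (k, j) (by simp) (by simpa using hm)).trans ?_
    rw [nsmul_eq_mul]
    gcongr
    · exact_mod_cast hJ
    · exact le_rfl

/-! ### Energies and Hausdorff dimension -/

lemma dist_le_half (x y : UnitAddCircle) : dist x y ≤ 1 / 2 := by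
  rw [dist_eq_norm]
  simpa using AddCircle.norm_le_half_period (p := 1) (x := x - y) one_ne_zero

/-- Off the diagonal a single term suffices: choose `n` with `2⁻⁽ⁿ⁺¹⁾ < 2 * dist x y ≤ 2⁻ⁿ`. The
factor `2` puts `y` in the open ball and explains the `k + 2`. On the diagonal the series diverges.
-/
lemma edist_rpow_neg_le_tsum {u : ℝ} (hu : 0 ≤ u) (x y : UnitAddCircle) :
    edist x y ^ (-u) ≤ ∑' k : ℕ, (2 : ℝ≥0∞) ^ (u * (k + 2)) *
      (Metric.ball x ((1 / 2) ^ k)).indicator 1 y := by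
  rcases eq_or_ne x y with rfl | hxy
  · calc _ ≤ ∑' _ : ℕ, (1 : ℝ≥0∞) :=
          le_top.trans (ENNReal.tsum_const_eq_top_of_ne_zero one_ne_zero).ge
      _ ≤ _ := ENNReal.tsum_le_tsum fun k => by
          rw [Set.indicator_of_mem (Metric.mem_ball_self (by positivity)), Pi.one_apply, mul_one]
          rw [← ENNReal.rpow_zero (x := 2)]
          exact ENNReal.rpow_le_rpow_of_exponent_le (by norm_num) (by positivity)
  · have hpos : 0 < dist x y := dist_pos.2 hxy
    obtain ⟨n, hn1, hn2⟩ := exists_nat_pow_near_of_lt_one (x := 2 * dist x y) (by positivity)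
      (by linarith [dist_le_half x y]) (by norm_num : (0 : ℝ) < 1 / 2) (by norm_num)
    refine le_trans ?_ (ENNReal.le_tsum n)
    have hmem : y ∈ Metric.ball x ((1 / 2) ^ n) := by
      rw [Metric.mem_ball, dist_comm]
      linarith
    rw [Set.indicator_of_mem hmem, Pi.one_apply, mul_one]
    have hlow : (2 : ℝ≥0∞) ^ (-((n : ℝ) + 2)) ≤ edist x y := by
      have : (2 : ℝ) ^ (-((n : ℝ) + 2)) ≤ dist x y := by
        rw [Real.rpow_neg (by norm_num), Real.rpow_add (by norm_num), Real.rpow_natCast]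
        rw [one_div, inv_pow, pow_succ] at hn1
        norm_num at hn1 ⊢
        linarith
      rw [edist_dist]
      refine le_trans (le_of_eq ?_) (ENNReal.ofReal_le_ofReal this)
      rw [← ENNReal.ofReal_rpow_of_pos (by norm_num)]
      norm_num
    calc edist x y ^ (-u) ≤ ((2 : ℝ≥0∞) ^ (-((n : ℝ) + 2))) ^ (-u) := by
          rw [ENNReal.rpow_neg, ENNReal.rpow_neg]
          gcongr
      _ = _ := by
          rw [← ENNReal.rpow_mul]
          ring_nf

lemma lintegral_edist_rpow_neg_lt_top {μ : Measure UnitAddCircle} [IsFiniteMeasure μ]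
    {s u : ℝ} (hu : 0 ≤ u) (hus : u < s) {C : ℝ≥0∞} (hC : C ≠ ∞)
    (hμ : ∀ x (k : ℕ), μ (Metric.ball x ((1 / 2) ^ k)) ≤ C * 2 ^ (-(s * k))) :
    ∫⁻ x, ∫⁻ y, edist x y ^ (-u) ∂μ ∂μ ≠ ∞ := by
  set B : ℝ≥0∞ := ∑' k : ℕ, (2 : ℝ≥0∞) ^ (u * (k + 2)) * (C * 2 ^ (-(s * k))) with hB
  have hBtop : B ≠ ∞ := by
    have h1 : ∀ k : ℕ, (2 : ℝ≥0∞) ^ (u * (k + 2)) * (C * 2 ^ (-(s * k))) =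
        C * 2 ^ (u * 2) * ((2 : ℝ≥0∞) ^ (u - s)) ^ k := fun k => by
      rw [← ENNReal.rpow_natCast, ← ENNReal.rpow_mul]
      have e1 : u * (k + 2) = u * k + u * 2 := by ring
      have e2 : (u - s) * k = u * k + (-(s * k)) := by ring
      rw [e1, e2, ENNReal.rpow_add _ _ (by norm_num) (by norm_num),
        ENNReal.rpow_add _ _ (by norm_num) (by norm_num)]
      ring
    rw [hB]
    simp_rw [h1]
    rw [ENNReal.tsum_mul_left, ENNReal.tsum_geometric]
    refine ENNReal.mul_ne_top (ENNReal.mul_ne_top hC (ENNReal.rpow_ne_top_of_ne_zero (by norm_num)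
      (by norm_num))) (ENNReal.inv_ne_top.2 ?_)
    rw [Ne, tsub_eq_zero_iff_le, not_le]
    exact ENNReal.rpow_lt_one_of_one_lt_of_neg (by norm_num) (by linarith)
  have hx : ∀ x, ∫⁻ y, edist x y ^ (-u) ∂μ ≤ B := fun x => by
    calc _ ≤ ∫⁻ y, ∑' k : ℕ, (2 : ℝ≥0∞) ^ (u * (k + 2)) *
          (Metric.ball x ((1 / 2) ^ k)).indicator 1 y ∂μ :=
          lintegral_mono fun y => edist_rpow_neg_le_tsum hu x y
      _ = ∑' k : ℕ, ∫⁻ y, (2 : ℝ≥0∞) ^ (u * (k + 2)) *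
          (Metric.ball x ((1 / 2) ^ k)).indicator 1 y ∂μ :=
          lintegral_tsum fun k => ((measurable_one.indicator
            Metric.isOpen_ball.measurableSet).const_mul _).aemeasurable
      _ ≤ B := by
          refine ENNReal.tsum_le_tsum fun k => ?_
          rw [lintegral_const_mul _ (measurable_one.indicator Metric.isOpen_ball.measurableSet),
            lintegral_indicator_one Metric.isOpen_ball.measurableSet]
          gcongr
          exact hμ x k
  refine ((lintegral_mono hx).trans_lt ?_).ne
  rw [lintegral_const]
  exact ENNReal.mul_lt_top hBtop.lt_top (measure_lt_top μ _)

section Dimension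

variable {X : Type*} [MetricSpace X]

lemma measurable_edist_rpow [MeasurableSpace X] [BorelSpace X] [SecondCountableTopology X]
    (u : ℝ) : Measurable fun p : X × X => edist p.1 p.2 ^ u :=
  (measurable_edist.comp (measurable_fst.prodMk measurable_snd)).pow_const u

/-- Mass distribution principle: on `U` the kernel seen from `x` is at least `ediam U ^ (-s)`, so a
bounded potential at a single point of `U` controls `ν U`. -/
lemma measure_le_mul_ediam_rpow [MeasurableSpace X] {ν : Measure X} {s : ℝ} (hs : 0 < s)
    {M : ℝ≥0∞} (hM : M ≠ ∞) (hM0 : M ≠ 0) {U : Set X} (hU : MeasurableSet U) {x : X} (hx : x ∈ U)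
    (hpot : ∫⁻ y, edist x y ^ (-s) ∂ν ≤ M) : ν U ≤ M * Metric.ediam U ^ s := by
  have h1 : Metric.ediam U ^ (-s) * ν U ≤ M := by
    calc _ = ∫⁻ _ in U, Metric.ediam U ^ (-s) ∂ν := by rw [setLIntegral_const]
      _ ≤ ∫⁻ y in U, edist x y ^ (-s) ∂ν := setLIntegral_mono' hU fun y hy => by
          rw [ENNReal.rpow_neg, ENNReal.rpow_neg]
          gcongr
          exact Metric.edist_le_ediam_of_mem hx hy
      _ ≤ ∫⁻ y, edist x y ^ (-s) ∂ν := setLIntegral_le_lintegral _ _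
      _ ≤ M := hpot
  rw [ENNReal.rpow_neg, mul_comm, ← div_eq_mul_inv] at h1
  exact (ENNReal.div_le_iff_le_mul (Or.inr hM) (Or.inr hM0)).1 h1

lemma exists_isOpen_ediam_rpow_le {s : ℝ} (hs : 0 < s) {t : Set X} (ht : Metric.ediam t ≠ ∞)
    {ε : ℝ≥0∞} (hε : ε ≠ 0) :
    ∃ U, IsOpen U ∧ t ⊆ U ∧ Metric.ediam U ^ s ≤ Metric.ediam t ^ s + ε := by
  have hcont : Tendsto (fun δ : ℝ≥0 => (Metric.ediam t + 2 * (δ : ℝ≥0∞)) ^ s) (𝓝[>] 0)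
      (𝓝 (Metric.ediam t ^ s)) := by
    have : Continuous fun δ : ℝ≥0 => (Metric.ediam t + 2 * (δ : ℝ≥0∞)) ^ s := by
      refine ENNReal.continuous_rpow_const.comp (continuous_const.add ?_)
      exact (ENNReal.continuous_const_mul (by norm_num)).comp ENNReal.continuous_coe
    have h := this.tendsto 0
    simp only [ENNReal.coe_zero, mul_zero, add_zero] at h
    exact h.mono_left nhdsWithin_le_nhds
  have hlt : Metric.ediam t ^ s < Metric.ediam t ^ s + ε :=
    ENNReal.lt_add_right (ENNReal.rpow_ne_top_of_nonneg hs.le ht) hε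
  obtain ⟨δ, hδ, hpos⟩ := ((hcont.eventually_lt_const hlt).and self_mem_nhdsWithin).exists
  refine ⟨Metric.thickening δ t, Metric.isOpen_thickening,
    Metric.self_subset_thickening (by exact_mod_cast hpos) t, le_trans ?_ hδ.le⟩
  gcongr
  exact Metric.ediam_thickening_le δ

/-- A decreasing intersection of compact sets has dimension at least `s` if infinitely many of them
carry measures with mass bounded below and `s`-energy bounded above. -/
theorem le_dimH_iInter_of_frequently_energy_le [MeasurableSpace X] [BorelSpace X]
    [SecondCountableTopology X] {s : ℝ≥0} (hs : 0 < s) {K : ℕ → Set X}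
    (hK : ∀ n, IsCompact (K n)) (hanti : Antitone K) {c L : ℝ≥0∞} (hc : c ≠ 0) (hL : L ≠ ∞)
    (h : ∃ᶠ n in atTop, ∃ ν : Measure X, IsFiniteMeasure ν ∧ ν (K n)ᶜ = 0 ∧ c ≤ ν Set.univ ∧
      ∫⁻ x, ∫⁻ y, edist x y ^ (-(s : ℝ)) ∂ν ∂ν ≤ L) :
    (s : ℝ≥0∞) ≤ dimH (⋂ n, K n) := by
  have hctop : c ≠ ∞ := by
    obtain ⟨n, ν, hν, -, hcν, -⟩ := h.exists
    exact (hcν.trans_lt (measure_lt_top ν _)).ne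
  have hs' : (0 : ℝ) < s := by exact_mod_cast hs
  have hc2 : c / 2 ≠ 0 := (ENNReal.half_pos hc).ne'
  have hc2' : c / 2 ≠ ∞ := (ENNReal.half_lt_self hc hctop).trans_le le_top |>.ne
  -- By Markov the potential reaches `M` only on mass at most `L / M ≤ c / 2`, so half of `c`
  -- remains on the good set `G`. The `+ 1` keeps `M` nonzero.
  set M : ℝ≥0∞ := (L + 1) / (c / 2) with hM
  have hM0 : M ≠ 0 := ENNReal.div_ne_zero.2 ⟨by simp, hc2'⟩
  have hMtop : M ≠ ∞ := ENNReal.div_ne_top (by simp [hL]) hc2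
  have hLM : L / M ≤ c / 2 := by
    rw [ENNReal.div_le_iff hM0 hMtop, hM, ENNReal.mul_div_cancel hc2 hc2']
    exact le_self_add
  refine le_dimH_of_hausdorffMeasure_ne_zero (ne_of_gt ?_)
  refine (ENNReal.div_pos hc2 hMtop).trans_le ?_
  rw [Measure.hausdorffMeasure_apply]
  refine le_iSup₂_of_le 1 one_pos (le_iInf₂ fun t ht => le_iInf fun htd => ?_)
  refine ENNReal.le_of_forall_pos_le_add fun ε hε _ => ?_
  obtain ⟨ε', hε'pos, hε'sum⟩ := ENNReal.exists_pos_sum_of_countable (ε := ε)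
    (by exact_mod_cast hε.ne') ℕ
  have hex : ∀ i, ∃ U, IsOpen U ∧ t i ⊆ U ∧ (U.Nonempty → Metric.ediam U ^ (s : ℝ) ≤
      (⨆ _ : (t i).Nonempty, Metric.ediam (t i) ^ (s : ℝ)) + ε' i) := fun i => by
    rcases (t i).eq_empty_or_nonempty with he | hne
    · exact ⟨∅, isOpen_empty, he.le, fun h => absurd h Set.not_nonempty_empty⟩
    · obtain ⟨U, hU, htU, hle⟩ := exists_isOpen_ediam_rpow_le hs' (t := t i)
        ((htd i).trans_lt ENNReal.one_lt_top).ne (ε := ε' i) (by exact_mod_cast (hε'pos i).ne')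
      exact ⟨U, hU, htU, fun _ => by rwa [iSup_pos hne]⟩
  choose U hUo htU hUd using hex
  -- An open cover of the intersection already covers some `K n`, so the measure on `K n` can be
  -- tested directly and no limit of the measures is needed.
  obtain ⟨J, hJ⟩ := exists_subset_nhds_of_isCompact hanti.directed_ge hK
    (U := ⋃ i, U i) (fun x hx => (isOpen_iUnion hUo).mem_nhds
      (Set.iUnion_mono htU (ht hx)))
  obtain ⟨n, hn, ν, hν, hνK, hcν, hνL⟩ := (frequently_atTop.1 h J)
  set G : Set X := {x | ∫⁻ y, edist x y ^ (-(s : ℝ)) ∂ν < M} with hG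
  have hmeas : Measurable fun x => ∫⁻ y, edist x y ^ (-(s : ℝ)) ∂ν :=
    (measurable_edist_rpow (X := X) (-(s : ℝ))).lintegral_prod_right'
  have hGm : MeasurableSet G := measurableSet_lt hmeas measurable_const
  have hGc : ν Gᶜ ≤ c / 2 := by
    refine le_trans (le_of_eq ?_) ((meas_ge_le_lintegral_div hmeas.aemeasurable hM0 hMtop).trans
      ((ENNReal.div_le_div_right hνL M).trans hLM))
    congr 1
    ext x
    simp [hG]
  have hGmass : c / 2 ≤ ν G := by
    have h1 : c / 2 + c / 2 ≤ ν G + c / 2 := by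
      rw [ENNReal.add_halves]
      exact hcν.trans ((measure_add_measure_compl hGm).ge.trans (by gcongr))
    exact (ENNReal.add_le_add_iff_right hc2').1 h1
  have hcov : ν G ≤ ∑' i, ν (G ∩ U i) := by
    refine le_trans (measure_mono_ae ?_) (measure_iUnion_le _)
    have : ∀ᵐ x ∂ν, x ∈ K n := hνK
    filter_upwards [this] with x hx hxG
    obtain ⟨i, hi⟩ := Set.mem_iUnion.1 (hJ (hanti hn hx))
    exact Set.mem_iUnion.2 ⟨i, hxG, hi⟩
  rw [ENNReal.div_le_iff hM0 hMtop]
  calc c / 2 ≤ ∑' i, ν (G ∩ U i) := hGmass.trans hcov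
    _ ≤ ∑' i, M * ((⨆ _ : (t i).Nonempty, Metric.ediam (t i) ^ (s : ℝ)) + ε' i) := by
        refine ENNReal.tsum_le_tsum fun i => ?_
        rcases (G ∩ U i).eq_empty_or_nonempty with he | ⟨x, hxG, hxU⟩
        · simp [he]
        · refine (measure_mono Set.inter_subset_right).trans
            ((measure_le_mul_ediam_rpow hs' hMtop hM0 (hUo i).measurableSet hxU hxG.le).trans ?_)
          gcongr
          exact hUd i ⟨x, hxU⟩
    _ = M * (∑' i, (⨆ _ : (t i).Nonempty, Metric.ediam (t i) ^ (s : ℝ)) + ∑' i, (ε' i : ℝ≥0∞)) := by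
        rw [ENNReal.tsum_mul_left, ENNReal.tsum_add]
    _ ≤ _ := by
        rw [mul_comm]
        gcongr

end Dimension

/-! ### Random measures on the uncovered set -/

lemma volume_compl_ball (x : UnitAddCircle) {r : ℝ} (h0 : 0 ≤ r) (hr : 2 * r ≤ 1) :
    volume (Metric.ball x r)ᶜ = ENNReal.ofReal (1 - 2 * r) := by
  have hball : volume (Metric.ball x r) = ENNReal.ofReal (2 * r) := by
    rw [← measure_congr AddCircle.closedBall_ae_eq_ball, AddCircle.volume_closedBall,
      min_eq_right hr]
  rw [measure_compl Metric.isOpen_ball.measurableSet (measure_ne_top _ _), hball,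
    UnitAddCircle.measure_univ, ENNReal.ofReal_sub _ (by positivity), ENNReal.ofReal_one]

/-- The indicator function of the complement of the arc of length `ρ` centred at `c`, normalized so
that its mean over all `c` is `1`. -/
noncomputable def gapDensity (ρ : ℝ) (c x : UnitAddCircle) : ℝ≥0∞ :=
  (Metric.ball c (ρ / 2))ᶜ.indicator (fun _ => ENNReal.ofReal (1 - ρ)⁻¹) x

/-- The correlation of the normalized indicator functions at two points. -/
noncomputable def gapCorrelation (ρ : ℝ) (x y : UnitAddCircle) : ℝ≥0∞ :=
  ∫⁻ c, gapDensity ρ c x * gapDensity ρ c y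

lemma measurable_gapDensity {α : Type*} [MeasurableSpace α] (ρ : ℝ) {f g : α → UnitAddCircle}
    (hf : Measurable f) (hg : Measurable g) : Measurable fun a => gapDensity ρ (f a) (g a) := by
  have h : MeasurableSet {a | ρ / 2 ≤ dist (g a) (f a)} :=
    measurableSet_le measurable_const (hg.dist hf)
  have : (fun a => gapDensity ρ (f a) (g a)) =
      {a | ρ / 2 ≤ dist (g a) (f a)}.indicator fun _ => ENNReal.ofReal (1 - ρ)⁻¹ := by
    ext a
    simp [gapDensity, Set.indicator]
  rw [this]
  exact measurable_const.indicator h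

lemma gapDensity_eq_indicator (ρ : ℝ) (x : UnitAddCircle) :
    (fun c => gapDensity ρ c x) =
      (Metric.ball x (ρ / 2))ᶜ.indicator fun _ => ENNReal.ofReal (1 - ρ)⁻¹ := by
  ext c
  simp [gapDensity, Set.indicator, dist_comm]

lemma gapDensity_le (ρ : ℝ) (c x : UnitAddCircle) :
    gapDensity ρ c x ≤ ENNReal.ofReal (1 - ρ)⁻¹ :=
  Set.indicator_le_self' (fun _ _ => zero_le) x

lemma lintegral_gapDensity {ρ : ℝ} (hρ0 : 0 < ρ) (hρ : ρ < 1) (x : UnitAddCircle) :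
    ∫⁻ c, gapDensity ρ c x = 1 := by
  rw [gapDensity_eq_indicator, lintegral_indicator Metric.isOpen_ball.measurableSet.compl,
    setLIntegral_const, volume_compl_ball x (by linarith) (by linarith),
    ← ENNReal.ofReal_mul (inv_nonneg.2 (by linarith)), mul_div_cancel₀ _ two_ne_zero,
    inv_mul_cancel₀ (by linarith), ENNReal.ofReal_one]

lemma gapCorrelation_le {ρ : ℝ} (hρ0 : 0 < ρ) (hρ : ρ < 1) (x y : UnitAddCircle) :
    gapCorrelation ρ x y ≤ ENNReal.ofReal (1 - ρ)⁻¹ := by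
  calc gapCorrelation ρ x y ≤ ∫⁻ c, gapDensity ρ c x * ENNReal.ofReal (1 - ρ)⁻¹ :=
        lintegral_mono fun c => by gcongr; exact gapDensity_le ρ c y
    _ = _ := by
        rw [lintegral_mul_const _ (measurable_gapDensity ρ measurable_id' measurable_const), lintegral_gapDensity hρ0 hρ,
          one_mul]

/-- The centres whose arcs hit `x` and those whose arcs hit `y` form disjoint arcs, so the
correlation equals `(1 - 2ρ) / (1 - ρ)² ≤ 1`. -/
lemma gapCorrelation_le_one {ρ : ℝ} (hρ0 : 0 < ρ) (hρ : ρ < 1) {x y : UnitAddCircle}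
    (h : ρ ≤ dist x y) : gapCorrelation ρ x y ≤ 1 := by
  have hρ2 : 2 * ρ ≤ 1 := by linarith [dist_le_half x y]
  have hball : ∀ z : UnitAddCircle, volume (Metric.ball z (ρ / 2)) = ENNReal.ofReal ρ := fun z => by
    rw [← measure_congr AddCircle.closedBall_ae_eq_ball, AddCircle.volume_closedBall,
      min_eq_right (by linarith), mul_div_cancel₀ _ two_ne_zero]
  have hdisj : Disjoint (Metric.ball x (ρ / 2)) (Metric.ball y (ρ / 2)) :=
    Metric.ball_disjoint_ball (by linarith)
  have hm := fun z : UnitAddCircle => (Metric.isOpen_ball (x := z) (ε := ρ / 2)).measurableSet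
  have hvol : volume ((Metric.ball x (ρ / 2))ᶜ ∩ (Metric.ball y (ρ / 2))ᶜ) =
      ENNReal.ofReal (1 - 2 * ρ) := by
    rw [← Set.compl_union, measure_compl ((hm x).union (hm y)) (measure_ne_top _ _),
      measure_union hdisj (hm y), hball, hball, UnitAddCircle.measure_univ,
      ENNReal.ofReal_sub _ (by positivity), ENNReal.ofReal_one, two_mul,
      ENNReal.ofReal_add hρ0.le hρ0.le]
  have hfun : (fun c => gapDensity ρ c x * gapDensity ρ c y) =
      ((Metric.ball x (ρ / 2))ᶜ ∩ (Metric.ball y (ρ / 2))ᶜ).indicator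
        fun _ => ENNReal.ofReal (1 - ρ)⁻¹ * ENNReal.ofReal (1 - ρ)⁻¹ := by
    ext c
    rw [congrFun (gapDensity_eq_indicator ρ x) c, congrFun (gapDensity_eq_indicator ρ y) c,
      Set.inter_indicator_mul]
  rw [gapCorrelation, hfun, lintegral_indicator ((hm x).compl.inter (hm y).compl),
    setLIntegral_const, hvol, ← ENNReal.ofReal_mul (inv_nonneg.2 (by linarith)),
    ← ENNReal.ofReal_mul (mul_self_nonneg _), ← ENNReal.ofReal_one]
  refine ENNReal.ofReal_le_ofReal ?_
  have h1 : 0 < 1 - ρ := by linarith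
  rw [← mul_inv, inv_mul_le_iff₀ (by positivity)]
  nlinarith

section Random

variable {Ω : Type*} [MeasurableSpace Ω] {P : Measure Ω} {ω : ℕ+ → Ω → UnitAddCircle}

/-- The product of the normalized indicator functions of the complements of the arcs with indices in
`F`. -/
noncomputable def gapProduct (ρ : ℕ+ → ℝ) (F : Finset ℕ+) (c : ℕ+ → UnitAddCircle)
    (x : UnitAddCircle) : ℝ≥0∞ := ∏ k ∈ F, gapDensity (ρ k) (c k) x

lemma measurable_gapProduct {α : Type*} [MeasurableSpace α] (ρ : ℕ+ → ℝ) (F : Finset ℕ+)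
    {c : α → ℕ+ → UnitAddCircle} {f : α → UnitAddCircle} (hc : ∀ n, Measurable fun a => c a n)
    (hf : Measurable f) : Measurable fun a => gapProduct ρ F (c a) (f a) :=
  Finset.measurable_fun_prod F fun k _ => measurable_gapDensity (ρ k) (hc k) hf

lemma lintegral_prod_comp_eq (hm : ∀ n, Measurable (ω n)) (hind : iIndepFun ω P)
    (hlaw : ∀ n, HasLaw (ω n) (volume : Measure UnitAddCircle) P) (F : Finset ℕ+)
    {f : ℕ+ → UnitAddCircle → ℝ≥0∞} (hf : ∀ k, Measurable (f k)) :
    ∫⁻ w, ∏ k ∈ F, f k (ω k w) ∂P = ∏ k ∈ F, ∫⁻ c, f k c := by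
  rw [lintegral_prod_eq_prod_lintegral_of_indepFun F (fun k w => f k (ω k w))
    (hind.comp f hf) fun k => (hf k).comp (hm k)]
  exact Finset.prod_congr rfl fun k _ => (hlaw k).lintegral_comp (hf k).aemeasurable

lemma lintegral_gapProduct_mass [IsProbabilityMeasure P] (hm : ∀ n, Measurable (ω n))
    (hind : iIndepFun ω P) (hlaw : ∀ n, HasLaw (ω n) (volume : Measure UnitAddCircle) P)
    {ρ : ℕ+ → ℝ} (hρ : ∀ k, ρ k ∈ Set.Ioo (0 : ℝ) 1) (μ : Measure UnitAddCircle)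
    [IsProbabilityMeasure μ] (F : Finset ℕ+) :
    ∫⁻ w, ∫⁻ x, gapProduct ρ F (fun n => ω n w) x ∂μ ∂P = 1 := by
  rw [lintegral_lintegral_swap]
  · have : ∀ x, ∫⁻ w, gapProduct ρ F (fun n => ω n w) x ∂P = 1 := fun x => by
      simp only [gapProduct]
      rw [lintegral_prod_comp_eq hm hind hlaw F (f := fun k c => gapDensity (ρ k) c x)
        fun k => measurable_gapDensity _ measurable_id measurable_const]
      exact Finset.prod_eq_one fun k _ => lintegral_gapDensity (hρ k).1 (hρ k).2 x
    simp [this]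
  · exact (measurable_gapProduct ρ F (fun n => (hm n).comp measurable_fst)
      measurable_snd).aemeasurable

lemma lintegral_gapProduct_energy [IsProbabilityMeasure P] (hm : ∀ n, Measurable (ω n))
    (hind : iIndepFun ω P) (hlaw : ∀ n, HasLaw (ω n) (volume : Measure UnitAddCircle) P)
    (ρ : ℕ+ → ℝ) (μ : Measure UnitAddCircle) [IsProbabilityMeasure μ] (F : Finset ℕ+)
    {g : UnitAddCircle × UnitAddCircle → ℝ≥0∞} (hg : Measurable g) :
    ∫⁻ w, ∫⁻ z, g z * (gapProduct ρ F (fun n => ω n w) z.1 *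
      gapProduct ρ F (fun n => ω n w) z.2) ∂(μ.prod μ) ∂P =
    ∫⁻ z, g z * ∏ k ∈ F, gapCorrelation (ρ k) z.1 z.2 ∂(μ.prod μ) := by
  rw [lintegral_lintegral_swap]
  · refine lintegral_congr fun z => ?_
    have hz : ∀ x, Measurable fun w => gapProduct ρ F (fun n => ω n w) x := fun x =>
      measurable_gapProduct ρ F hm measurable_const
    rw [lintegral_const_mul _ ((hz z.1).fun_mul (hz z.2))]
    congr 1
    simp only [gapProduct, ← Finset.prod_mul_distrib]
    exact lintegral_prod_comp_eq hm hind hlaw F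
      (f := fun k c => gapDensity (ρ k) c z.1 * gapDensity (ρ k) c z.2)
      fun k => (measurable_gapDensity _ measurable_id measurable_const).mul
        (measurable_gapDensity _ measurable_id measurable_const)
  · have h1 := measurable_gapProduct (α := Ω × (UnitAddCircle × UnitAddCircle)) ρ F
      (fun n => (hm n).comp measurable_fst) measurable_snd.fst
    have h2 := measurable_gapProduct (α := Ω × (UnitAddCircle × UnitAddCircle)) ρ F
      (fun n => (hm n).comp measurable_fst) measurable_snd.snd
    exact ((hg.comp measurable_snd).mul (h1.mul h2)).aemeasurable

end Random

lemma gapProduct_eq_zero {ρ : ℕ+ → ℝ} {F : Finset ℕ+} {c : ℕ+ → UnitAddCircle} {x : UnitAddCircle}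
    {k : ℕ+} (hk : k ∈ F) (hx : x ∈ Metric.ball (c k) (ρ k / 2)) : gapProduct ρ F c x = 0 :=
  Finset.prod_eq_zero hk (Set.indicator_of_notMem (by simpa using hx) _)

lemma gapProduct_le (ρ : ℕ+ → ℝ) (F : Finset ℕ+) (c : ℕ+ → UnitAddCircle) (x : UnitAddCircle) :
    gapProduct ρ F c x ≤ ∏ k ∈ F, ENNReal.ofReal (1 - ρ k)⁻¹ :=
  Finset.prod_le_prod' fun k _ => gapDensity_le (ρ k) (c k) x

/-- A second moment bound for the lower tail of a variable of mean one. -/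
lemma measure_lt_half_le {Ω : Type*} [MeasurableSpace Ω] {P : Measure Ω} [IsProbabilityMeasure P]
    {M : Ω → ℝ≥0∞} (hM : Measurable M) (h1 : ∫⁻ w, M w ∂P = 1) {ε : ℝ≥0∞}
    (h2 : ∫⁻ w, M w ^ 2 ∂P ≤ 1 + ε) : P {w | M w < 1 / 2} ≤ 4 * ε := by
  have hS : MeasurableSet {w | M w < 1 / 2} := measurableSet_lt hM measurable_const
  -- Chebyshev's inequality `1_{M < 1/2} / 4 ≤ (M - 1)²`, expanded so that no subtraction occurs in
  -- `ℝ≥0∞`.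
  have hpt : ∀ w, {w | M w < 1 / 2}.indicator (fun _ => (1 / 4 : ℝ≥0∞)) w + 2 * M w ≤
      M w ^ 2 + 1 := by
    intro w
    rcases eq_or_ne (M w) ∞ with h | h
    · simp [h]
    lift M w to ℝ≥0 using h with m hm
    by_cases hlt : (m : ℝ≥0∞) < 1 / 2
    · have hw : w ∈ {w | M w < 1 / 2} := by simpa [← hm] using hlt
      rw [Set.indicator_of_mem hw]
      have e : (1 / 4 : ℝ≥0∞) = ((1 / 4 : ℝ≥0) : ℝ≥0∞) := by norm_num
      have e2 : (1 / 2 : ℝ≥0∞) = ((1 / 2 : ℝ≥0) : ℝ≥0∞) := by norm_num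
      rw [e2, ENNReal.coe_lt_coe] at hlt
      rw [e]
      norm_cast
      rw [← NNReal.coe_le_coe]
      rw [← NNReal.coe_lt_coe] at hlt
      push_cast at hlt ⊢
      nlinarith
    · have hw : w ∉ {w | M w < 1 / 2} := by simpa [← hm] using hlt
      rw [Set.indicator_of_notMem hw, zero_add]
      norm_cast
      rw [← NNReal.coe_le_coe]
      push_cast
      nlinarith [sq_nonneg ((m : ℝ) - 1)]
  have hint := lintegral_mono (μ := P) hpt
  rw [lintegral_add_left (measurable_const.indicator hS), lintegral_indicator hS,
    setLIntegral_const, lintegral_const_mul _ hM, h1, lintegral_add_right _ measurable_const,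
    lintegral_const, measure_univ, mul_one, mul_one] at hint
  have h3 : 1 / 4 * P {w | M w < 1 / 2} + 2 ≤ ε + 2 := by
    refine hint.trans ((add_le_add_left h2 1).trans (le_of_eq ?_))
    rw [add_right_comm, one_add_one_eq_two, add_comm]
  have h4 := (ENNReal.add_le_add_iff_right (by norm_num)).1 h3
  calc P {w | M w < 1 / 2} = 4 * (1 / 4 * P {w | M w < 1 / 2}) := by
        rw [← mul_assoc, ENNReal.mul_div_cancel (by norm_num) (by norm_num), one_mul]
    _ ≤ 4 * ε := by gcongr

lemma lintegral_energy_withDensity {X : Type*} [MetricSpace X] [MeasurableSpace X] [BorelSpace X]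
    [SecondCountableTopology X] (μ : Measure X) [SFinite μ] (s : ℝ)
    {D : X → ℝ≥0∞} (hD : Measurable D) :
    ∫⁻ x, ∫⁻ y, edist x y ^ s ∂(μ.withDensity D) ∂(μ.withDensity D) =
      ∫⁻ z, edist z.1 z.2 ^ s * (D z.1 * D z.2) ∂(μ.prod μ) := by
  have hk : Measurable fun p : X × X => edist p.1 p.2 ^ s :=
    measurable_edist_rpow s
  have hDD : Measurable fun z : X × X => D z.1 * D z.2 :=
    (hD.comp measurable_fst).mul (hD.comp measurable_snd)
  have hinner : ∀ x, Measurable fun y : X => edist x y ^ s := fun x =>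
    hk.comp (measurable_const.prodMk measurable_id)
  rw [lintegral_prod _ (hk.fun_mul hDD).aemeasurable]
  have h1 : ∀ x, ∫⁻ y, edist x y ^ s ∂(μ.withDensity D) = ∫⁻ y, D y * edist x y ^ s ∂μ := fun x =>
    lintegral_withDensity_eq_lintegral_mul μ hD (hinner x)
  simp_rw [h1]
  have hprod : Measurable fun p : X × X => D p.2 * edist p.1 p.2 ^ s :=
    (hD.comp measurable_snd).mul hk
  rw [lintegral_withDensity_eq_lintegral_mul μ hD hprod.lintegral_prod_right']
  refine lintegral_congr fun x => ?_
  rw [Pi.mul_apply, ← lintegral_const_mul _ (hD.fun_mul (hinner x))]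
  exact lintegral_congr fun y => by ring

/-- If the correlations of the gaps along an increasing sequence of finite sets of arcs are bounded
in mean, then with high probability the uncovered part of `K` is large. -/
theorem measure_not_le_dimH_gap_le {Ω : Type*} [MeasurableSpace Ω] {P : Measure Ω}
    [IsProbabilityMeasure P] {ω : ℕ+ → Ω → UnitAddCircle} (hm : ∀ n, Measurable (ω n))
    (hind : iIndepFun ω P) (hlaw : ∀ n, HasLaw (ω n) (volume : Measure UnitAddCircle) P)
    {ρ : ℕ+ → ℝ} (hρ : ∀ k, ρ k ∈ Set.Ioo (0 : ℝ) 1) {μ : Measure UnitAddCircle}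
    [IsProbabilityMeasure μ] {K : Set UnitAddCircle} (hK : IsCompact K) (hμK : μ Kᶜ = 0)
    {F : ℕ → Finset ℕ+} (hF : Monotone F) {s : ℝ≥0} (hs : 0 < s) {ε I : ℝ≥0∞} (hε : ε ≠ 0)
    (hI : I ≠ ∞)
    (hmass : ∀ J, ∫⁻ z, ∏ k ∈ F J, gapCorrelation (ρ k) z.1 z.2 ∂(μ.prod μ) ≤ 1 + ε)
    (henergy : ∀ J, ∫⁻ z, edist z.1 z.2 ^ (-(s : ℝ)) *
      ∏ k ∈ F J, gapCorrelation (ρ k) z.1 z.2 ∂(μ.prod μ) ≤ I) :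
    P {w | ¬ (s : ℝ≥0∞) ≤
      dimH {x ∈ K | ∀ J, ∀ k ∈ F J, x ∉ Metric.ball (ω k w) (ρ k / 2)}} ≤ 5 * ε := by
  rcases eq_or_ne ε ∞ with rfl | hεtop
  · simp
  set D : ℕ → Ω → UnitAddCircle → ℝ≥0∞ := fun J w => gapProduct ρ (F J) (fun n => ω n w) with hD
  have hDm : ∀ J w, Measurable (D J w) := fun J w =>
    measurable_gapProduct ρ (F J) (fun n => measurable_const) measurable_id'
  have hD1 : ∀ J, Measurable fun p : Ω × UnitAddCircle => D J p.1 p.2 := fun J =>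
    measurable_gapProduct ρ (F J) (fun n => (hm n).comp measurable_fst) measurable_snd
  have hD2 : ∀ J, Measurable fun p : Ω × (UnitAddCircle × UnitAddCircle) =>
      D J p.1 p.2.1 * D J p.1 p.2.2 := fun J =>
    (measurable_gapProduct ρ (F J) (fun n => (hm n).comp measurable_fst) measurable_snd.fst).mul
      (measurable_gapProduct ρ (F J) (fun n => (hm n).comp measurable_fst) measurable_snd.snd)
  set M : ℕ → Ω → ℝ≥0∞ := fun J w => ∫⁻ x, D J w x ∂μ with hM
  set E : ℕ → Ω → ℝ≥0∞ := fun J w =>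
    ∫⁻ z, edist z.1 z.2 ^ (-(s : ℝ)) * (D J w z.1 * D J w z.2) ∂(μ.prod μ) with hE
  have hMm : ∀ J, Measurable (M J) := fun J => (hD1 J).lintegral_prod_right'
  have hEm : ∀ J, Measurable (E J) := fun J =>
    (((measurable_edist_rpow (X := UnitAddCircle) (-(s : ℝ))).comp measurable_snd).mul
      (hD2 J)).lintegral_prod_right'
  have hM1 : ∀ J, ∫⁻ w, M J w ∂P = 1 := fun J => lintegral_gapProduct_mass hm hind hlaw hρ μ (F J)
  have hM2 : ∀ J, ∫⁻ w, M J w ^ 2 ∂P ≤ 1 + ε := fun J => by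
    refine le_trans (le_of_eq ?_) (hmass J)
    have h := lintegral_gapProduct_energy hm hind hlaw ρ μ (F J) (g := fun _ => 1) measurable_const
    simp only [one_mul] at h
    rw [← h]
    refine lintegral_congr fun w => ?_
    rw [lintegral_prod_mul (hDm J w).aemeasurable (hDm J w).aemeasurable, sq]
  have hEI : ∀ J, ∫⁻ w, E J w ∂P ≤ I := fun J =>
    (lintegral_gapProduct_energy hm hind hlaw ρ μ (F J) (measurable_edist_rpow _)).trans_le
      (henergy J)
  -- Chosen so that Markov bounds the probability of energy at least `L` by `ε`; with the `4ε` for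
  -- small mass this gives `5ε`.
  set L : ℝ≥0∞ := (I + 1) / ε with hL
  have hL0 : L ≠ 0 := ENNReal.div_ne_zero.2 ⟨by simp, hεtop⟩
  have hLtop : L ≠ ∞ := ENNReal.div_ne_top (by simp [hI]) hε
  set bad : ℕ → Set Ω := fun J => {w | M J w < 1 / 2} ∪ {w | L ≤ E J w} with hbad
  have hPbad : ∀ J, P (bad J) ≤ 5 * ε := fun J => by
    refine (measure_union_le _ _).trans ((add_le_add (measure_lt_half_le (hMm J) (hM1 J) (hM2 J))
      (d := ε) ?_).trans (le_of_eq (by ring)))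
    refine (meas_ge_le_lintegral_div (hEm J).aemeasurable hL0 hLtop).trans ?_
    rw [ENNReal.div_le_iff hL0 hLtop, hL, ENNReal.mul_div_cancel hε hεtop]
    exact (hEI J).trans le_self_add
  -- Infinitely many good stages are enough for the dimension bound. Failure thus lies in the liminf
  -- of the bad events, whose probability is bounded by the uniform bound `5ε`, with no summability
  -- needed.
  have hsub : {w | ¬ (s : ℝ≥0∞) ≤
      dimH {x ∈ K | ∀ J, ∀ k ∈ F J, x ∉ Metric.ball (ω k w) (ρ k / 2)}} ⊆
      ⋃ N, ⋂ J ≥ N, bad J := by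
    intro w hw
    by_contra hcon
    apply hw
    have hfreq : ∃ᶠ J in atTop, w ∉ bad J := by
      rw [frequently_atTop]
      intro N
      by_contra! h
      exact hcon (Set.mem_iUnion.2 ⟨N, Set.mem_iInter₂.2 h⟩)
    have hset : {x ∈ K | ∀ J, ∀ k ∈ F J, x ∉ Metric.ball (ω k w) (ρ k / 2)} =
        ⋂ J, K ∩ ⋂ k ∈ F J, (Metric.ball (ω k w) (ρ k / 2))ᶜ := by
      ext x
      simp only [Set.mem_ofPred_eq, Set.mem_iInter, Set.mem_inter_iff, Set.mem_compl_iff]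
      exact ⟨fun h J => ⟨h.1, h.2 J⟩, fun h => ⟨(h 0).1, fun J => (h J).2⟩⟩
    rw [hset]
    refine le_dimH_iInter_of_frequently_energy_le hs (c := 1 / 2) (L := L) (fun J =>
      hK.inter_right (isClosed_biInter fun k _ => Metric.isOpen_ball.isClosed_compl))
      (fun J J' hJ => Set.inter_subset_inter_right _
        (Set.biInter_subset_biInter_left fun k hk => hF hJ hk)) (by simp) hLtop
      (hfreq.mono fun J hJ => ⟨μ.withDensity (D J w), ?_, ?_, ?_, ?_⟩)
    · refine isFiniteMeasure_withDensity ?_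
      refine ((lintegral_mono fun x => gapProduct_le ρ (F J) _ x).trans_lt ?_).ne
      rw [lintegral_const, measure_univ, mul_one]
      exact ENNReal.prod_lt_top fun k _ => ENNReal.ofReal_lt_top
    · rw [Set.compl_inter]
      refine measure_union_null (withDensity_absolutelyContinuous μ _ hμK) ?_
      rw [withDensity_apply_eq_zero (hDm J w)]
      refine measure_mono_null ?_ (measure_empty (μ := μ))
      rintro x ⟨hx0, hx⟩
      simp only [Set.compl_iInter, compl_compl, Set.mem_iUnion, exists_prop] at hx
      obtain ⟨k, hk, hxk⟩ := hx
      exact hx0 (gapProduct_eq_zero hk hxk)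
    · rw [withDensity_apply _ MeasurableSet.univ, Measure.restrict_univ]
      exact not_lt.1 fun h => hJ (Or.inl h)
    · rw [lintegral_energy_withDensity μ _ (hDm J w)]
      exact le_of_lt (not_le.1 fun h => hJ (Or.inr h))
  refine (measure_mono hsub).trans ?_
  have hmono : Monotone fun N => ⋂ J ≥ N, bad J := fun N N' hN =>
    Set.biInter_subset_biInter_left fun J hJ => le_trans hN hJ
  rw [hmono.measure_iUnion]
  exact iSup_le fun N => (measure_mono (Set.biInter_subset_of_mem (le_refl N))).trans (hPbad N)

/-! ### The lower bound for the dimension of the uncovered set -/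

lemma tendsto_pnat_cast_atTop : Tendsto (fun n : ℕ+ => (n : ℝ)) atTop atTop :=
  tendsto_natCast_atTop_atTop.comp tendsto_PNat_val_atTop_atTop

lemma frequently_mul_lt_log {ℓ : ℕ+ → ℝ} {b : ℝ} (hb : 0 < b)
    (h : lowerRate ℓ < ENNReal.ofReal b) :
    ∃ᶠ n : ℕ+ in atTop, (n : ℝ) * ℓ n < b * Real.log n := by
  have h1 := frequently_lt_of_liminf_lt (by isBoundedDefault) h
  have h2 : ∀ᶠ n : ℕ+ in atTop, 0 < Real.log (n : ℝ) := by
    filter_upwards [tendsto_pnat_cast_atTop.eventually_gt_atTop 1] with n hn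
    exact Real.log_pos hn
  refine (h1.and_eventually h2).mono fun n hn => ?_
  rw [ENNReal.ofReal_lt_ofReal_iff hb, div_lt_iff₀ hn.2] at hn
  exact hn.1

lemma tendsto_zero_of_frequently_mul_lt_log {ℓ : ℕ+ → ℝ} (hanti : Antitone ℓ)
    (hpos : ∀ n, 0 < ℓ n) {b : ℝ} (h : ∃ᶠ n : ℕ+ in atTop, (n : ℝ) * ℓ n < b * Real.log n) :
    Tendsto ℓ atTop (𝓝 0) := by
  rw [Metric.tendsto_atTop]
  intro ε hε
  have hlim : Tendsto (fun n : ℕ+ => b * (Real.log n / n)) atTop (𝓝 0) := by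
    have h0 : Tendsto (fun x : ℝ => Real.log x / x) atTop (𝓝 0) :=
      Real.isLittleO_log_id_atTop.tendsto_div_nhds_zero
    simpa using (h0.comp tendsto_pnat_cast_atTop).const_mul b
  obtain ⟨n, hn, hn'⟩ := (h.and_eventually (hlim.eventually_lt_const hε)).exists
  refine ⟨n, fun m hm => ?_⟩
  rw [Real.dist_eq, sub_zero, abs_of_pos (hpos m)]
  have hnpos : (0 : ℝ) < n := by exact_mod_cast n.pos
  calc ℓ m ≤ ℓ n := hanti hm
    _ < b * Real.log n / n := by rw [lt_div_iff₀ hnpos]; linarith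
    _ = b * (Real.log n / n) := by ring
    _ < ε := hn'

/-- If `n * ℓ n < b * log n` with `b < a`, then `(1 - ℓ n)⁻ⁿ` is about `exp (n * ℓ n)`, less than
about `n ^ b`, while `ℓ n ^ (-a)` is at least `n ^ a` up to a power of `log n`. -/
lemma frequently_inv_pow_le {ℓ : ℕ+ → ℝ} (hanti : Antitone ℓ)
    (hmem : ∀ n, ℓ n ∈ Set.Ioo (0 : ℝ) 1) {a : ℝ} (h : lowerRate ℓ < ENNReal.ofReal a) :
    Tendsto ℓ atTop (𝓝 0) ∧
      ∃ᶠ n : ℕ+ in atTop, ENNReal.ofReal (1 - ℓ n)⁻¹ ^ (n : ℕ) ≤ ENNReal.ofReal (ℓ n) ^ (-a) := by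
  have ha : 0 < a := ENNReal.ofReal_pos.1 (pos_of_gt h)
  obtain ⟨b₀, hb₀, hb₀'⟩ := exists_between h
  obtain ⟨b, hb, hba, hlt⟩ : ∃ b : ℝ, 0 < b ∧ b < a ∧ lowerRate ℓ < ENNReal.ofReal b := by
    have hfin : b₀ ≠ ∞ := (hb₀'.trans ENNReal.ofReal_lt_top).ne
    refine ⟨b₀.toReal, ENNReal.toReal_pos (pos_of_gt hb₀).ne' hfin, ?_, ?_⟩
    · rwa [← ENNReal.lt_ofReal_iff_toReal_lt hfin]
    · rwa [ENNReal.ofReal_toReal hfin]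
  have hfreq := frequently_mul_lt_log hb hlt
  have hlim := tendsto_zero_of_frequently_mul_lt_log hanti (fun n => (hmem n).1) hfreq
  refine ⟨hlim, ?_⟩
  -- The lower half of the gap `a - b` absorbs the factor `1 / (1 - ℓ n)`, the upper half the term
  -- `log (b * log n)`.
  set b' : ℝ := (a + b) / 2 with hb'
  have hsmall : ∀ᶠ n in atTop, b / (1 - ℓ n) < b' := by
    have : Tendsto (fun n => b / (1 - ℓ n)) atTop (𝓝 (b / (1 - 0))) :=
      tendsto_const_nhds.div (tendsto_const_nhds.sub hlim) (by norm_num)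
    rw [sub_zero, div_one] at this
    exact this.eventually_lt_const (by rw [hb']; linarith)
  have hloglog : ∀ᶠ n : ℕ+ in atTop,
      Real.log (b * Real.log n) ≤ (a - b') / a * Real.log n ∧ 0 < Real.log (n : ℝ) := by
    have hlog : Tendsto (fun n : ℕ+ => b * Real.log (n : ℝ)) atTop atTop :=
      (Real.tendsto_log_atTop.comp tendsto_pnat_cast_atTop).const_mul_atTop hb
    have hc : 0 < (a - b') / a / b := by
      have : 0 < a - b' := by rw [hb']; linarith
      positivity
    filter_upwards [hlog.eventually (Real.isLittleO_log_id_atTop.bound hc),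
      hlog.eventually_gt_atTop 0] with n hn hpos
    have hl : 0 < Real.log (n : ℝ) := pos_of_mul_pos_right hpos hb.le
    refine ⟨(le_abs_self _).trans (hn.trans (le_of_eq ?_)), hl⟩
    rw [id, Real.norm_eq_abs, abs_of_pos hpos]
    field_simp
  refine (hfreq.and_eventually (hsmall.and hloglog)).mono ?_
  rintro n ⟨h1, h2, h3, h4⟩
  have hn : (0 : ℝ) < n := by exact_mod_cast n.pos
  obtain ⟨hl0, hl1⟩ := hmem n
  have hsub : 0 < 1 - ℓ n := by linarith
  have key : (n : ℝ) * -Real.log (1 - ℓ n) ≤ a * -Real.log (ℓ n) := by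
    have e1 : -Real.log (1 - ℓ n) ≤ ℓ n / (1 - ℓ n) := by
      have := Real.one_sub_inv_le_log_of_pos hsub
      have e : ℓ n / (1 - ℓ n) = (1 - ℓ n)⁻¹ - 1 := by field_simp; ring
      rw [e]
      linarith
    have e2 : (n : ℝ) * -Real.log (1 - ℓ n) ≤ b' * Real.log n := by
      calc (n : ℝ) * -Real.log (1 - ℓ n) ≤ n * (ℓ n / (1 - ℓ n)) := by gcongr
        _ = (n * ℓ n) / (1 - ℓ n) := by ring
        _ ≤ b * Real.log n / (1 - ℓ n) := by gcongr
        _ = b / (1 - ℓ n) * Real.log n := by ring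
        _ ≤ b' * Real.log n := by gcongr
    have e3 : Real.log (ℓ n) ≤ Real.log (b * Real.log n) - Real.log n := by
      rw [← Real.log_div (by positivity) hn.ne']
      refine Real.log_le_log hl0 ?_
      rw [le_div_iff₀ hn]
      linarith
    have e4 : a * Real.log (b * Real.log n) ≤ (a - b') * Real.log n := by
      calc a * Real.log (b * Real.log n) ≤ a * ((a - b') / a * Real.log n) := by gcongr
        _ = _ := by field_simp
    nlinarith
  rw [← ENNReal.ofReal_pow (inv_nonneg.2 hsub.le), ENNReal.ofReal_rpow_of_pos hl0]
  refine ENNReal.ofReal_le_ofReal ?_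
  rw [← Real.log_le_log_iff (by positivity) (Real.rpow_pos_of_pos hl0 _), Real.log_pow,
    Real.log_inv, Real.log_rpow hl0]
  linarith

/-- By Markov, finite energy forces the strip around the diagonal to have measure at most a constant
times `r ^ u`; absolute continuity of the integral does the rest. -/
lemma tendsto_setLIntegral_edist_lt {X : Type*} [MetricSpace X] [MeasurableSpace X] [BorelSpace X]
    [SecondCountableTopology X] {μ : Measure (X × X)} {u : ℝ} (hu : 0 < u)
    (h : ∫⁻ z, edist z.1 z.2 ^ (-u) ∂μ ≠ ∞) {ι : Type*} {l : Filter ι} {r : ι → ℝ}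
    (hr : Tendsto r l (𝓝 0)) (hpos : ∀ i, 0 < r i) :
    Tendsto (fun i => ∫⁻ z in {z | edist z.1 z.2 < ENNReal.ofReal (r i)},
      edist z.1 z.2 ^ (-u) ∂μ) l (𝓝 0) := by
  refine tendsto_setLIntegral_zero h ?_
  have hlim : Tendsto (fun i => (∫⁻ z, edist z.1 z.2 ^ (-u) ∂μ) * ENNReal.ofReal (r i) ^ u) l
      (𝓝 0) := by
    have h1 : Tendsto (fun i => ENNReal.ofReal (r i) ^ u) l (𝓝 0) := by
      have h2 := (ENNReal.continuous_rpow_const (y := u)).tendsto 0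
      rw [ENNReal.zero_rpow_of_pos hu] at h2
      refine h2.comp ?_
      rw [← ENNReal.ofReal_zero]
      exact ENNReal.tendsto_ofReal hr
    simpa using ENNReal.Tendsto.const_mul h1 (Or.inr h)
  refine tendsto_of_tendsto_of_tendsto_of_le_of_le tendsto_const_nhds hlim
    (fun i => zero_le) fun i => ?_
  have hr0 : ENNReal.ofReal (r i) ≠ 0 := (ENNReal.ofReal_pos.2 (hpos i)).ne'
  have hrt : ENNReal.ofReal (r i) ≠ ∞ := ENNReal.ofReal_ne_top
  calc μ {z | edist z.1 z.2 < ENNReal.ofReal (r i)}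
      ≤ μ {z | ENNReal.ofReal (r i) ^ (-u) ≤ edist z.1 z.2 ^ (-u)} := by
        refine measure_mono fun z hz => ?_
        simp only [Set.mem_ofPred_eq] at hz ⊢
        rw [ENNReal.rpow_neg, ENNReal.rpow_neg]
        gcongr
    _ ≤ (∫⁻ z, edist z.1 z.2 ^ (-u) ∂μ) / ENNReal.ofReal (r i) ^ (-u) :=
        meas_ge_le_lintegral_div (measurable_edist_rpow _).aemeasurable
          (ENNReal.rpow_pos (ENNReal.ofReal_pos.2 (hpos i)) hrt).ne'
          (ENNReal.rpow_ne_top_of_ne_zero hr0 hrt)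
    _ = _ := by rw [ENNReal.rpow_neg, div_eq_mul_inv, inv_inv]

/-! ### Sparse stages and the correlations they produce. -/

/-- The first `n` positive integers. -/
def firstIndices (n : ℕ) : Finset ℕ+ := (Finset.range n).map ⟨Nat.succPNat, Nat.succPNat_injective⟩

lemma mem_firstIndices {n : ℕ} {k : ℕ+} : k ∈ firstIndices n ↔ (k : ℕ) ≤ n := by
  simp only [firstIndices, Finset.mem_map, Finset.mem_range, Function.Embedding.coeFn_mk]
  constructor
  · rintro ⟨i, hi, rfl⟩
    rw [Nat.succPNat_coe]
    omega
  · exact fun h => ⟨k.natPred, by have := k.pos; rw [PNat.natPred]; omega, by simp⟩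

/-- The stage `j` at which the index `k` satisfies `k ≤ m j` for the first time. -/
noncomputable def stage (m : ℕ → ℕ) (k : ℕ+) : ℕ := sInf {j | (k : ℕ) ≤ m j}

lemma stage_eq {m : ℕ → ℕ} (hm : Monotone m) {k : ℕ+} {j : ℕ} (h1 : m j < k)
    (h2 : (k : ℕ) ≤ m (j + 1)) : stage m k = j + 1 := by
  refine le_antisymm (Nat.sInf_le h2) ?_
  by_contra! hlt
  have hmem : (k : ℕ) ≤ m (stage m k) := Nat.sInf_mem (s := {j | (k : ℕ) ≤ m j}) ⟨_, h2⟩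
  have := hm (Nat.lt_succ_iff.1 hlt)
  omega

/-- The cost of one stage. Far points contribute at most `1`; near points contribute at most `ρ ^
(-a)`, which is below `edist ^ (-a)` because the distance is less than `ρ`. -/
lemma gapCorrelation_prod_Ico_le {ρ : ℝ} (hρ : ρ ∈ Set.Ioo (0 : ℝ) 1) {a : ℝ} (ha : 0 ≤ a)
    {n : ℕ} (hn : ENNReal.ofReal (1 - ρ)⁻¹ ^ n ≤ ENNReal.ofReal ρ ^ (-a)) {m : ℕ} (hmn : m ≤ n)
    (z : UnitAddCircle × UnitAddCircle) :
    gapCorrelation ρ z.1 z.2 ^ m ≤ 1 + {z : UnitAddCircle × UnitAddCircle |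
      edist z.1 z.2 < ENNReal.ofReal ρ}.indicator (fun z => edist z.1 z.2 ^ (-a)) z := by
  by_cases hz : edist z.1 z.2 < ENNReal.ofReal ρ
  · refine le_add_left ?_
    rw [Set.indicator_of_mem (by exact hz)]
    calc gapCorrelation ρ z.1 z.2 ^ m ≤ ENNReal.ofReal (1 - ρ)⁻¹ ^ m := by
          gcongr
          exact gapCorrelation_le hρ.1 hρ.2 _ _
      _ ≤ ENNReal.ofReal (1 - ρ)⁻¹ ^ n := by
          refine pow_le_pow_right₀ ?_ hmn
          rw [ENNReal.one_le_ofReal]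
          exact (one_le_inv₀ (by linarith [hρ.2])).2 (by linarith [hρ.1])
      _ ≤ ENNReal.ofReal ρ ^ (-a) := hn
      _ ≤ edist z.1 z.2 ^ (-a) := by
          rw [ENNReal.rpow_neg, ENNReal.rpow_neg]
          gcongr
  · refine le_add_right (pow_le_one₀ zero_le (gapCorrelation_le_one hρ.1 hρ.2 ?_))
    rw [not_lt, edist_dist] at hz
    exact (ENNReal.ofReal_le_ofReal_iff dist_nonneg).1 hz

/-- Stage by stage, the new factor is `1` plus a term near the diagonal, and the earlier product is
bounded by a constant that depends only on `m j`. Each stage thus adds at most `ε j`. The weight `g`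
will be `1` for the second moment and `edist ^ (-s)` for the energy. -/
lemma lintegral_prod_gapCorrelation_le {ℓ : ℕ+ → ℝ} (hanti : Antitone ℓ)
    (hmem : ∀ n, ℓ n ∈ Set.Ioo (0 : ℝ) 1) {a u : ℝ} (ha : 0 ≤ a) {n : ℕ → ℕ+} (m : ℕ → ℕ)
    (hm0 : m 0 = 0) (hmn : ∀ j, m (j + 1) = n j) (hmono : Monotone m)
    (hgood : ∀ j, ENNReal.ofReal (1 - ℓ (n j))⁻¹ ^ (n j : ℕ) ≤ ENNReal.ofReal (ℓ (n j)) ^ (-a))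
    {μ : Measure (UnitAddCircle × UnitAddCircle)} {ε : ℕ → ℝ≥0∞}
    (hsmall : ∀ j, ENNReal.ofReal (1 - ℓ 1)⁻¹ ^ m j *
      ∫⁻ z in {z | edist z.1 z.2 < ENNReal.ofReal (ℓ (n j))}, edist z.1 z.2 ^ (-u) ∂μ ≤ ε j)
    {g : UnitAddCircle × UnitAddCircle → ℝ≥0∞}
    (hg : ∀ z, g z * edist z.1 z.2 ^ (-a) ≤ edist z.1 z.2 ^ (-u)) (J : ℕ) :
    ∫⁻ z, g z * ∏ k ∈ firstIndices (m J), gapCorrelation (ℓ (n (stage m k - 1))) z.1 z.2 ∂μ ≤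
      ∫⁻ z, g z ∂μ + ∑ j ∈ Finset.range J, ε j := by
  set ρ : ℕ+ → ℝ := fun k => ℓ (n (stage m k - 1)) with hρ
  have hρmem : ∀ k, ρ k ∈ Set.Ioo (0 : ℝ) 1 := fun k => hmem _
  have hbound : ∀ (j : ℕ) (z : UnitAddCircle × UnitAddCircle), ∏ k ∈ firstIndices (m j), gapCorrelation (ρ k) z.1 z.2 ≤
      ENNReal.ofReal (1 - ℓ 1)⁻¹ ^ m j := by
    intro j z
    calc ∏ k ∈ firstIndices (m j), gapCorrelation (ρ k) z.1 z.2
        ≤ ∏ k ∈ firstIndices (m j), ENNReal.ofReal (1 - ℓ 1)⁻¹ := by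
          refine Finset.prod_le_prod' fun k _ =>
            (gapCorrelation_le (hρmem k).1 (hρmem k).2 _ _).trans (ENNReal.ofReal_le_ofReal ?_)
          have h1 : ρ k ≤ ℓ 1 := hanti one_le
          exact inv_anti₀ (by linarith [(hmem 1).2]) (by linarith)
      _ = _ := by simp [firstIndices]
  have hstep : ∀ j z, g z * ∏ k ∈ firstIndices (m (j + 1)), gapCorrelation (ρ k) z.1 z.2 ≤
      g z * ∏ k ∈ firstIndices (m j), gapCorrelation (ρ k) z.1 z.2 +
        ENNReal.ofReal (1 - ℓ 1)⁻¹ ^ m j *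
          {z : UnitAddCircle × UnitAddCircle | edist z.1 z.2 < ENNReal.ofReal (ℓ (n j))}.indicator
            (fun z => edist z.1 z.2 ^ (-u)) z := by
    intro j z
    have hsplit : ∏ k ∈ firstIndices (m (j + 1)), gapCorrelation (ρ k) z.1 z.2 =
        (∏ k ∈ firstIndices (m j), gapCorrelation (ρ k) z.1 z.2) *
          gapCorrelation (ℓ (n j)) z.1 z.2 ^ (m (j + 1) - m j) := by
      simp only [firstIndices, Finset.prod_map, Function.Embedding.coeFn_mk]
      rw [← Finset.prod_range_mul_prod_Ico _ (hmono j.le_succ)]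
      congr 1
      rw [← Nat.card_Ico, ← Finset.prod_const]
      refine Finset.prod_congr rfl fun i hi => ?_
      rw [Finset.mem_Ico] at hi
      have : stage m i.succPNat = j + 1 := stage_eq hmono
        (by rw [Nat.succPNat_coe]; omega) (by rw [Nat.succPNat_coe]; omega)
      simp only [hρ, this, Nat.add_sub_cancel]
    rw [hsplit]
    have hb := gapCorrelation_prod_Ico_le (hmem (n j)) ha (hgood j)
      (m := m (j + 1) - m j) (by rw [hmn]; omega) z
    calc _ ≤ g z * ((∏ k ∈ firstIndices (m j), gapCorrelation (ρ k) z.1 z.2) *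
          (1 + {z : UnitAddCircle × UnitAddCircle |
            edist z.1 z.2 < ENNReal.ofReal (ℓ (n j))}.indicator
              (fun z => edist z.1 z.2 ^ (-a)) z)) := by gcongr
      _ = g z * (∏ k ∈ firstIndices (m j), gapCorrelation (ρ k) z.1 z.2) +
          (∏ k ∈ firstIndices (m j), gapCorrelation (ρ k) z.1 z.2) *
            (g z * {z : UnitAddCircle × UnitAddCircle |
              edist z.1 z.2 < ENNReal.ofReal (ℓ (n j))}.indicator
                (fun z => edist z.1 z.2 ^ (-a)) z) := by ring
      _ ≤ _ := by
          gcongr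
          · exact hbound j z
          · by_cases hz : z ∈ {z : UnitAddCircle × UnitAddCircle |
              edist z.1 z.2 < ENNReal.ofReal (ℓ (n j))}
            · rw [Set.indicator_of_mem hz, Set.indicator_of_mem hz]
              exact hg z
            · rw [Set.indicator_of_notMem hz, Set.indicator_of_notMem hz, mul_zero]
  induction J with
  | zero => simp [hm0, firstIndices]
  | succ J ih =>
    have hker : Measurable fun z : UnitAddCircle × UnitAddCircle => edist z.1 z.2 ^ (-u) :=
      measurable_edist_rpow (-u)
    have hset : MeasurableSet {z : UnitAddCircle × UnitAddCircle |
        edist z.1 z.2 < ENNReal.ofReal (ℓ (n J))} :=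
      measurableSet_lt (measurable_fst.edist measurable_snd) measurable_const
    refine (lintegral_mono (hstep J)).trans ?_
    rw [lintegral_add_right _ ((hker.indicator hset).const_mul _),
      lintegral_const_mul _ (hker.indicator hset), lintegral_indicator hset,
      Finset.sum_range_succ, ← add_assoc]
    exact add_le_add ih (hsmall J)

/-- The uncovered part of an analytic set has large dimension almost surely. -/
theorem ae_le_dimH_diff_uniformlyCovered {Ω : Type*} [MeasurableSpace Ω] {P : Measure Ω}
    [IsProbabilityMeasure P] {ω : ℕ+ → Ω → UnitAddCircle} (hm : ∀ n, Measurable (ω n))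
    (hind : iIndepFun ω P) (hlaw : ∀ n, HasLaw (ω n) (volume : Measure UnitAddCircle) P)
    {ℓ : ℕ+ → ℝ} (hanti : Antitone ℓ) (hmem : ∀ n, ℓ n ∈ Set.Ioo (0 : ℝ) 1)
    {A : Set UnitAddCircle} (hA : AnalyticSet A) {s : ℝ≥0} (hs : 0 < s)
    (h : lowerRate ℓ + s < dimH A) :
    ∀ᵐ w ∂P, (s : ℝ≥0∞) ≤ dimH (A \ uniformlyCovered ℓ (fun n => ω n w)) := by
  -- The exponents satisfy `lowerRate ℓ < a` and `u = s + a < t < dimH A`: `a` is the loss caused by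
  -- the arcs, `t` the Frostman exponent.
  obtain ⟨t, ht1, ht2⟩ := ENNReal.lt_iff_exists_nnreal_btwn.1 h
  have hst : s < t := by exact_mod_cast (le_add_self.trans_lt ht1)
  have hrate : lowerRate ℓ < ((t - s : ℝ≥0) : ℝ≥0∞) := by
    rw [ENNReal.coe_sub]
    exact lt_tsub_iff_right.2 ht1
  obtain ⟨a, ha1, ha2⟩ := ENNReal.lt_iff_exists_nnreal_btwn.1 hrate
  have hat : a < t - s := by exact_mod_cast ha2
  have ha0 : 0 < a := by exact_mod_cast pos_of_gt ha1
  have hsat : (s : ℝ) + a < t := by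
    have h1 : s + a < t := by rw [add_comm]; exact lt_tsub_iff_right.1 hat
    exact_mod_cast h1
  obtain ⟨hlim, hfreq⟩ := frequently_inv_pow_le hanti hmem (a := a) (by simpa using ha1)
  obtain ⟨K, hKA, hK, μ, C, hμ, hC, hμK, hball⟩ := exists_frostman_measure hA (hs.trans hst) ht2
  set u : ℝ := s + a with hu
  have hu0 : 0 < u := by positivity
  have hker : ∀ v : ℝ, Measurable fun z : UnitAddCircle × UnitAddCircle => edist z.1 z.2 ^ v :=
    measurable_edist_rpow
  have hfin : ∀ v : ℝ, 0 ≤ v → v < t →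
      ∫⁻ z, edist z.1 z.2 ^ (-v) ∂(μ.prod μ) ≠ ∞ := fun v hv hvt => by
    rw [lintegral_prod _ (hker (-v)).aemeasurable]
    exact lintegral_edist_rpow_neg_lt_top hv hvt hC hball
  have htail := tendsto_setLIntegral_edist_lt hu0 (hfin u hu0.le hsat) hlim fun n => (hmem n).1
  have hedist : ∀ x y : UnitAddCircle, edist x y ≤ 1 := fun x y => by
    rw [edist_dist, ← ENNReal.ofReal_one]
    exact ENNReal.ofReal_le_ofReal ((dist_le_half x y).trans (by norm_num))
  have key : ∀ ε : ℝ≥0, 0 < ε → P {w | ¬ (s : ℝ≥0∞) ≤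
      dimH (A \ uniformlyCovered ℓ (fun n => ω n w))} ≤ 5 * ε := by
    intro ε hε
    obtain ⟨ε', hε'pos, hε'sum⟩ := ENNReal.exists_pos_sum_of_countable (ε := ε)
      (by exact_mod_cast hε.ne') ℕ
    -- The constant `(1 - ℓ 1)⁻¹ ^ m` is fixed before `n` is chosen, so the shrinking strip can beat
    -- it.
    have hnext : ∀ j m : ℕ, ∃ n : ℕ+, m < n ∧
        ENNReal.ofReal (1 - ℓ n)⁻¹ ^ (n : ℕ) ≤ ENNReal.ofReal (ℓ n) ^ (-(a : ℝ)) ∧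
        ENNReal.ofReal (1 - ℓ 1)⁻¹ ^ m *
          ∫⁻ z in {z | edist z.1 z.2 < ENNReal.ofReal (ℓ n)}, edist z.1 z.2 ^ (-u) ∂(μ.prod μ) ≤
            ε' j := by
      intro j m
      have h1 := ENNReal.Tendsto.const_mul (a := ENNReal.ofReal (1 - ℓ 1)⁻¹ ^ m) htail
        (Or.inr (ENNReal.pow_ne_top ENNReal.ofReal_ne_top))
      rw [mul_zero] at h1
      have h2 := h1.eventually_le_const (u := (ε' j : ℝ≥0∞)) (by exact_mod_cast hε'pos j)
      obtain ⟨n, hn1, hn2, hn3⟩ := (hfreq.and_eventually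
        (h2.and (tendsto_PNat_val_atTop_atTop.eventually_gt_atTop m))).exists
      exact ⟨n, hn3, hn1, hn2⟩
    choose next hnext1 hnext2 hnext3 using hnext
    let m : ℕ → ℕ := fun j => Nat.rec 0 (fun j m => (next j m : ℕ)) j
    let n : ℕ → ℕ+ := fun j => next j (m j)
    have hmn : ∀ j, m (j + 1) = n j := fun j => rfl
    have hmono : StrictMono m := strictMono_nat_of_lt_succ fun j => hnext1 j (m j)
    -- Since `m 0 = 0 < k`, the stage is at least `1` and the subtraction is harmless: `ρ k = ℓ (n
    -- j)` for `m j < k ≤ m (j + 1) = n j`.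
    set ρ : ℕ+ → ℝ := fun k => ℓ (n (stage m k - 1)) with hρ
    have hsum : ∀ J, ∑ j ∈ Finset.range J, (ε' j : ℝ≥0∞) ≤ ε := fun J =>
      (ENNReal.sum_le_tsum _).trans hε'sum.le
    have hcorr := fun (g : UnitAddCircle × UnitAddCircle → ℝ≥0∞)
      (hg : ∀ z, g z * edist z.1 z.2 ^ (-(a : ℝ)) ≤ edist z.1 z.2 ^ (-u)) (J : ℕ) =>
      (lintegral_prod_gapCorrelation_le hanti hmem a.2 m rfl hmn hmono.monotone
        (fun j => hnext2 j (m j)) (fun j => hnext3 j (m j)) hg J).trans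
        (add_le_add_right (hsum J) _)
    refine le_trans (measure_mono ?_) (measure_not_le_dimH_gap_le hm hind hlaw (ρ := ρ)
      (fun k => hmem _) hK hμK (F := fun J => firstIndices (m J)) (s := s) (ε := ε)
      (I := ∫⁻ z, edist z.1 z.2 ^ (-(s : ℝ)) ∂(μ.prod μ) + ε) ?_ hs ?_ ?_ ?_ ?_)
    · intro w hw hcon
      refine hw (hcon.trans (dimH_mono ?_))
      rintro x ⟨hxK, hx⟩
      refine ⟨hKA hxK, fun hxU => ?_⟩
      rw [uniformlyCovered, mem_liminf_iff_eventually_mem] at hxU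
      have hn_lim : Tendsto n atTop atTop := by
        refine tendsto_atTop_mono (f := fun j => j.succPNat) (fun j => ?_) ?_
        · rw [← PNat.coe_le_coe, Nat.succPNat_coe, ← hmn]
          exact hmono.le_apply
        · exact tendsto_atTop_mono (fun j => le_rfl) (Filter.tendsto_atTop_atTop.2 fun b =>
            ⟨b, fun j hj => by
              rw [← PNat.coe_le_coe, Nat.succPNat_coe]; omega⟩)
      -- At time `n j` the point is covered by an arc of length `ℓ (n j)` and index `k ≤ n j`. This
      -- is at most `ρ k`, so the fixed arc of index `k` covers it too.
      obtain ⟨j, hj⟩ := (hn_lim.eventually hxU).exists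
      simp only [coveredAt, Set.mem_iUnion, exists_prop] at hj
      obtain ⟨k, hk, hxk⟩ := hj
      have hkm : (k : ℕ) ≤ m (j + 1) := by rw [hmn]; exact_mod_cast hk
      refine hx (j + 1) k (mem_firstIndices.2 hkm) (Metric.ball_subset_ball ?_ hxk)
      have hle : ℓ (n j) ≤ ρ k := hanti (by
        rw [← PNat.coe_le_coe, ← hmn, ← hmn]
        have hst : stage m k ≤ j + 1 := Nat.sInf_le hkm
        have hst' : stage m k - 1 + 1 ≤ j + 1 := by omega
        exact hmono.monotone hst')
      linarith
    · exact fun J J' hJ k hk => mem_firstIndices.2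
        ((mem_firstIndices.1 hk).trans (hmono.monotone hJ))
    · exact_mod_cast hε.ne'
    · exact ENNReal.add_ne_top.2 ⟨hfin s s.2 (by linarith [a.2, hsat]), ENNReal.coe_ne_top⟩
    · intro J
      have := hcorr (fun _ => 1) (fun z => ?_) J
      · simpa using this
      · rw [one_mul]
        exact ENNReal.rpow_le_rpow_of_exponent_ge (hedist _ _) (by rw [hu]; linarith [s.2])
    · refine hcorr _ fun z => ?_
      rcases eq_or_ne (edist z.1 z.2) 0 with h0 | h0
      · rw [h0, ENNReal.zero_rpow_of_neg (y := -u) (by linarith)]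
        exact le_top
      · rw [← ENNReal.rpow_add _ _ h0 (edist_ne_top _ _), hu]
        exact le_of_eq (by ring_nf)
  rw [ae_iff]
  refine le_antisymm (ENNReal.le_of_forall_pos_le_add fun ε hε _ => ?_) zero_le
  rw [zero_add]
  refine (key (ε / 5) (by positivity)).trans (le_of_eq ?_)
  rw [ENNReal.coe_div (by norm_num)]
  exact ENNReal.mul_div_cancel (by norm_num) (by norm_num)

/-! ### Covering of sets of small box-counting dimension -/

lemma exists_isCover_encard_le {X : Type*} [PseudoEMetricSpace X] {r : ℝ≥0} {A : Set X}
    (h : Metric.externalCoveringNumber r A ≠ ⊤) :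
    ∃ C : Set X, Metric.IsCover r A C ∧ C.encard ≤ Metric.externalCoveringNumber r A := by
  have hlt : Metric.externalCoveringNumber r A < Metric.externalCoveringNumber r A + 1 :=
    (ENat.lt_add_one_iff h).2 le_rfl
  conv_lhs at hlt => rw [Metric.externalCoveringNumber]
  simp only [iInf_lt_iff] at hlt
  obtain ⟨C, hC, hlt⟩ := hlt
  exact ⟨C, hC, (ENat.lt_add_one_iff h).1 hlt⟩

section Covering

variable {Ω : Type*} [MeasurableSpace Ω] {P : Measure Ω} {ω : ℕ+ → Ω → UnitAddCircle}

lemma measure_forall_notMem_ball_le (hind : iIndepFun ω P)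
    (hlaw : ∀ n, HasLaw (ω n) (volume : Measure UnitAddCircle) P) (c : UnitAddCircle) {q : ℝ}
    (hq0 : 0 ≤ q) (hq1 : 2 * q ≤ 1) (n : ℕ+) :
    P {w | ∀ k ≤ n, ω k w ∉ Metric.ball c q} ≤ ENNReal.ofReal (Real.exp (-(n * (2 * q)))) := by
  have hset : {w | ∀ k ≤ n, ω k w ∉ Metric.ball c q} =
      ⋂ k ∈ firstIndices n, ω k ⁻¹' (Metric.ball c q)ᶜ := by
    ext w
    simp [mem_firstIndices]
  have hms : MeasurableSet (Metric.ball c q)ᶜ := Metric.isOpen_ball.measurableSet.compl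
  have hone : ∀ k, P (ω k ⁻¹' (Metric.ball c q)ᶜ) = ENNReal.ofReal (1 - 2 * q) := fun k => by
    rw [← Measure.map_apply_of_aemeasurable (hlaw k).aemeasurable hms, (hlaw k).map_eq,
      volume_compl_ball c hq0 hq1]
  rw [hset, hind.measure_inter_preimage_eq_mul _ fun k _ => hms]
  simp_rw [hone]
  rw [Finset.prod_const, firstIndices, Finset.card_map, Finset.card_range,
    ← ENNReal.ofReal_pow (by linarith)]
  refine ENNReal.ofReal_le_ofReal ?_
  calc (1 - 2 * q) ^ (n : ℕ) ≤ Real.exp (-(2 * q)) ^ (n : ℕ) := by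
        have := Real.one_sub_le_exp_neg (2 * q)
        exact pow_le_pow_left₀ (by linarith) this _
    _ = _ := by
        rw [← Real.exp_nat_mul]
        ring_nf

/-- An arc whose centre is within `ℓ n / 2 - r` of `c` contains the whole closed ball of radius `r`
about `c`. The bound is a union bound over the centres of an optimal cover. -/
lemma measure_not_subset_coveredAt_le (hind : iIndepFun ω P)
    (hlaw : ∀ n, HasLaw (ω n) (volume : Measure UnitAddCircle) P) {ℓ : ℕ+ → ℝ} (n : ℕ+)
    (hmem : ℓ n ∈ Set.Ioo (0 : ℝ) 1) (A : Set UnitAddCircle) {r : ℝ≥0} (hr : 2 * (r : ℝ) ≤ ℓ n) :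
    P {w | ¬ A ⊆ coveredAt ℓ (fun k => ω k w) n} ≤
      (Metric.externalCoveringNumber r A : ℝ≥0∞) *
        ENNReal.ofReal (Real.exp (-(n * (ℓ n - 2 * r)))) := by
  by_cases htop : Metric.externalCoveringNumber r A = ⊤
  · rw [htop, ENat.toENNReal_top, ENNReal.top_mul (ENNReal.ofReal_pos.2 (Real.exp_pos _)).ne']
    exact le_top
  obtain ⟨C, hC, hcard⟩ := exists_isCover_encard_le htop
  have hfin : C.Finite := Set.encard_ne_top_iff.1 (ne_top_of_le_ne_top htop hcard)
  have hsub : {w | ¬ A ⊆ coveredAt ℓ (fun k => ω k w) n} ⊆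
      ⋃ c ∈ hfin.toFinset, {w | ∀ k ≤ n, ω k w ∉ Metric.ball c (ℓ n / 2 - r)} := by
    intro w hw
    obtain ⟨x, hxA, hx⟩ := Set.not_subset.1 hw
    obtain ⟨c, hcC, hxc⟩ := hC hxA
    have hxc' : dist x c ≤ r := by
      have : edist x c ≤ r := hxc
      rwa [edist_nndist, ENNReal.coe_le_coe, ← NNReal.coe_le_coe, coe_nndist] at this
    refine Set.mem_iUnion₂.2 ⟨c, hfin.mem_toFinset.2 hcC, fun k hk hball => hx ?_⟩
    refine Set.mem_iUnion₂.2 ⟨k, hk, ?_⟩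
    rw [Metric.mem_ball] at hball ⊢
    rw [dist_comm] at hball
    linarith [dist_triangle x c (ω k w)]
  calc P {w | ¬ A ⊆ coveredAt ℓ (fun k => ω k w) n}
      ≤ ∑ c ∈ hfin.toFinset, P {w | ∀ k ≤ n, ω k w ∉ Metric.ball c (ℓ n / 2 - r)} :=
        (measure_mono hsub).trans (measure_biUnion_finset_le _ _)
    _ ≤ ∑ _c ∈ hfin.toFinset, ENNReal.ofReal (Real.exp (-(n * (ℓ n - 2 * r)))) := by
        refine Finset.sum_le_sum fun c _ => (measure_forall_notMem_ball_le hind hlaw c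
          (by linarith) (by linarith [hmem.2, r.2]) n).trans (le_of_eq ?_)
        ring_nf
    _ ≤ _ := by
        rw [Finset.sum_const, nsmul_eq_mul]
        gcongr
        rw [hfin.encard_eq_coe_toFinset_card] at hcard
        exact_mod_cast ENat.toENNReal_le.2 hcard

/-- Borel–Cantelli with covers at scale `κ * ℓ n`. The condition `κ < (1 - d) / 2` leaves `ℓ n - 2r
≥ d * ℓ n`, and `κ < r₀` makes the covering bound available for every `n`, at the price of the
constant `κ ^ (-β)`. -/
lemma ae_subset_uniformlyCovered_of_covering_le (hind : iIndepFun ω P)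
    (hlaw : ∀ n, HasLaw (ω n) (volume : Measure UnitAddCircle) P) {ℓ : ℕ+ → ℝ}
    (hmem : ∀ n, ℓ n ∈ Set.Ioo (0 : ℝ) 1) {A : Set UnitAddCircle} {β : ℝ}
    (hA : ∀ᶠ r : ℝ≥0 in 𝓝[>] 0,
      (Metric.externalCoveringNumber r A : ℝ≥0∞) ≤ ENNReal.ofReal ((r : ℝ) ^ (-β)))
    {d : ℝ} (hd0 : 0 < d) (hd1 : d < 1)
    (hsum : Summable fun n : ℕ+ => (1 / ℓ n) ^ β * Real.exp (-((n : ℝ) * d * ℓ n))) :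
    ∀ᵐ w ∂P, A ⊆ uniformlyCovered ℓ (fun n => ω n w) := by
  obtain ⟨r₀, hr₀, hr₀A⟩ := mem_nhdsGT_iff_exists_Ioo_subset.1 hA
  obtain ⟨κ, hκ0, hκ⟩ : ∃ κ : ℝ≥0, 0 < κ ∧ κ < min r₀ (Real.toNNReal ((1 - d) / 2)) :=
    exists_between (lt_min hr₀ (Real.toNNReal_pos.2 (by linarith)))
  have hκr : κ < r₀ := hκ.trans_le (min_le_left _ _)
  have hκd : (κ : ℝ) < (1 - d) / 2 := by
    have := hκ.trans_le (min_le_right _ _)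
    rwa [← NNReal.coe_lt_coe, Real.coe_toNNReal _ (by linarith)] at this
  have hκ0' : (0 : ℝ) < κ := by exact_mod_cast hκ0
  set f : ℕ+ → ℝ := fun n => (1 / ℓ n) ^ β * Real.exp (-((n : ℝ) * d * ℓ n)) with hf
  have hbad : ∀ n, P {w | ¬ A ⊆ coveredAt ℓ (fun k => ω k w) n} ≤
      ENNReal.ofReal ((κ : ℝ) ^ (-β) * f n) := by
    intro n
    obtain ⟨hl0, hl1⟩ := hmem n
    set r : ℝ≥0 := κ * Real.toNNReal (ℓ n) with hr
    have hrcoe : (r : ℝ) = κ * ℓ n := by rw [hr, NNReal.coe_mul, Real.coe_toNNReal _ hl0.le]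
    have hr0 : 0 < r := mul_pos hκ0 (Real.toNNReal_pos.2 hl0)
    have hrr : r < r₀ := by
      refine lt_of_le_of_lt ?_ hκr
      rw [← NNReal.coe_le_coe, hrcoe]
      exact mul_le_of_le_one_right hκ0'.le hl1.le
    have hrd : 2 * (r : ℝ) ≤ (1 - d) * ℓ n := by
      rw [hrcoe, ← mul_assoc]
      gcongr
      linarith
    have hdl : 0 < d * ℓ n := by positivity
    refine (measure_not_subset_coveredAt_le hind hlaw n (hmem n) A (r := r) (by linarith)).trans ?_
    refine (mul_le_mul' (hr₀A ⟨hr0, hrr⟩) (ENNReal.ofReal_le_ofReal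
      (Real.exp_le_exp.2 (neg_le_neg (a := (n : ℝ) * (d * ℓ n)) ?_)))).trans (le_of_eq ?_)
    · gcongr
      linarith
    · rw [← ENNReal.ofReal_mul (by positivity), hrcoe, Real.mul_rpow hκ0'.le hl0.le, hf]
      simp only
      rw [one_div, Real.inv_rpow hl0.le, ← Real.rpow_neg hl0.le]
      ring_nf
  have hfinite := ae_finite_setOfPred_mem (μ := P)
    (s := fun n : ℕ+ => {w | ¬ A ⊆ coveredAt ℓ (fun k => ω k w) n}) ?_
  · filter_upwards [hfinite] with w hw x hx
    rw [uniformlyCovered, mem_liminf_iff_eventually_mem]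
    obtain ⟨N, hN⟩ := hw.bddAbove
    filter_upwards [eventually_gt_atTop N] with n hn
    by_contra hcon
    exact absurd (hN (show n ∈ {n | ¬ A ⊆ coveredAt ℓ (fun k => ω k w) n} from
      fun hsub => hcon (hsub hx))) (not_le.2 hn)
  · exact ne_top_of_le_ne_top (hsum.mul_left _).tsum_ofReal_ne_top (ENNReal.tsum_le_tsum hbad)

end Covering

/-- Each of the `n` terms with index in `[n, 2n)` is at least `exp (-2 n d ℓ n)`, because `ℓ` is
antitone and `(1 / ℓ) ^ β ≥ 1`. So `n * exp (-2 n d ℓ n)` is bounded; taking logarithms and giving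
up half of `log n` yields `1 / (4d)`. -/
lemma exists_mul_log_le_of_summable {ℓ : ℕ+ → ℝ} (hanti : Antitone ℓ)
    (hmem : ∀ n, ℓ n ∈ Set.Ioo (0 : ℝ) 1) {β d : ℝ} (hβ : 0 ≤ β) (hd : 0 < d)
    (hsum : Summable fun n : ℕ+ => (1 / ℓ n) ^ β * Real.exp (-((n : ℝ) * d * ℓ n))) :
    ∃ c > 0, ∀ᶠ n : ℕ+ in atTop, c * Real.log n ≤ n * ℓ n := by
  set f : ℕ+ → ℝ := fun n => (1 / ℓ n) ^ β * Real.exp (-((n : ℝ) * d * ℓ n)) with hf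
  have hf0 : ∀ n, 0 ≤ f n := fun n => mul_nonneg
    (Real.rpow_nonneg (by have := (hmem n).1; positivity) _) (Real.exp_pos _).le
  set S : ℝ := ∑' n, f n + 1 with hS
  have hS0 : 0 < S := by have : 0 ≤ ∑' n, f n := tsum_nonneg hf0; linarith
  have hblock : ∀ n : ℕ+, (n : ℝ) * Real.exp (-(2 * n * d * ℓ n)) ≤ S := by
    intro n
    have h1 : ∑ k ∈ Finset.Ico n (2 * n), f k ≤ S := by
      have := hsum.sum_le_tsum (Finset.Ico n (2 * n)) fun k _ => hf0 k
      linarith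
    refine le_trans ?_ h1
    have hcard : ((Finset.Ico n (2 * n)).card : ℝ) = n := by
      rw [PNat.card_Ico]
      congr 1
      rw [PNat.mul_coe]
      simp only [PNat.val_ofNat]
      omega
    rw [← hcard, ← nsmul_eq_mul, hcard]
    refine Finset.card_nsmul_le_sum _ _ _ fun k hk => ?_
    rw [Finset.mem_Ico] at hk
    have hk2 : (k : ℝ) ≤ 2 * n := by exact_mod_cast hk.2.le
    have hlk := hmem k
    have hln := hmem n
    have hle : ℓ k ≤ ℓ n := hanti hk.1
    calc Real.exp (-(2 * n * d * ℓ n)) ≤ Real.exp (-((k : ℝ) * d * ℓ k)) := by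
          refine Real.exp_le_exp.2 (neg_le_neg ?_)
          have := hlk.1.le
          gcongr
      _ = 1 * Real.exp (-((k : ℝ) * d * ℓ k)) := (one_mul _).symm
      _ ≤ f k := by
          refine mul_le_mul_of_nonneg_right (Real.one_le_rpow ?_ hβ) (Real.exp_pos _).le
          rw [le_div_iff₀ hlk.1]
          linarith [hlk.2]
  refine ⟨1 / (4 * d), by positivity, ?_⟩
  have hlog : Tendsto (fun n : ℕ+ => Real.log (n : ℝ)) atTop atTop :=
    Real.tendsto_log_atTop.comp tendsto_pnat_cast_atTop
  filter_upwards [hlog.eventually_ge_atTop (2 * Real.log S)] with n hn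
  have hn0 : (0 : ℝ) < n := by exact_mod_cast n.pos
  have h1 := Real.log_le_log (by positivity) (hblock n)
  rw [Real.log_mul hn0.ne' (Real.exp_pos _).ne', Real.log_exp] at h1
  rw [one_div_mul_eq_div, div_le_iff₀ (by positivity)]
  linarith

/-- The gained factor `exp (-(d' - d) n ℓ n)` is eventually at most `n ^ (-c (d' - d))`, and `1 / ℓ
n ≤ n` eventually. The strict increase of `β` matters because a box dimension at most `β` bounds
covering numbers only with exponents above `β`. -/
lemma exists_summable_of_summable {ℓ : ℕ+ → ℝ} (hanti : Antitone ℓ)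
    (hmem : ∀ n, ℓ n ∈ Set.Ioo (0 : ℝ) 1) {β d d' : ℝ} (hβ : 0 ≤ β) (hd : 0 < d) (hdd : d < d')
    (hsum : Summable fun n : ℕ+ => (1 / ℓ n) ^ β * Real.exp (-((n : ℝ) * d * ℓ n))) :
    ∃ β' > β, Summable fun n : ℕ+ => (1 / ℓ n) ^ β' * Real.exp (-((n : ℝ) * d' * ℓ n)) := by
  obtain ⟨c, hc, hlog⟩ := exists_mul_log_le_of_summable hanti hmem hβ hd hsum
  have hd0 : 0 < d' - d := by linarith
  refine ⟨β + c * (d' - d), by nlinarith [mul_pos hc hd0], ?_⟩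
  refine Summable.of_norm_bounded_eventually hsum ?_
  have hev : ∀ᶠ n : ℕ+ in atTop, ‖(1 / ℓ n) ^ (β + c * (d' - d)) *
      Real.exp (-((n : ℝ) * d' * ℓ n))‖ ≤ (1 / ℓ n) ^ β * Real.exp (-((n : ℝ) * d * ℓ n)) := by
    have hlim : Tendsto (fun n : ℕ+ => Real.log (n : ℝ)) atTop atTop :=
      Real.tendsto_log_atTop.comp tendsto_pnat_cast_atTop
    filter_upwards [hlog, hlim.eventually_ge_atTop (1 / c)] with n hn hn'
    have hn0 : (0 : ℝ) < n := by exact_mod_cast n.pos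
    obtain ⟨hl0, hl1⟩ := hmem n
    have hinv : 0 < 1 / ℓ n := by positivity
    have h1 : 1 ≤ n * ℓ n := by
      rw [div_le_iff₀' hc] at hn'
      linarith
    have h2 : Real.log (1 / ℓ n) ≤ Real.log n :=
      Real.log_le_log hinv (by rw [div_le_iff₀ hl0]; linarith)
    rw [Real.norm_of_nonneg (by positivity), Real.rpow_add hinv, mul_assoc]
    refine mul_le_mul_of_nonneg_left ?_ (by positivity)
    rw [Real.rpow_def_of_pos hinv, ← Real.exp_add]
    refine Real.exp_le_exp.2 ?_
    nlinarith [mul_le_mul_of_nonneg_left h2 hc.le]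
  obtain ⟨N, hN⟩ := eventually_atTop.1 hev
  exact ((Set.finite_Iio N).subset fun n hn => not_le.1 fun h => hn (hN n h))

lemma nonneg_of_upperBoxDim_le {X : Type*} [PseudoEMetricSpace X] {A : Set X} (hA : A.Nonempty)
    {β : ℝ} (h : upperBoxDim A ≤ (β : EReal)) : 0 ≤ β := by
  have h0 : (0 : EReal) ≤ upperBoxDim A := by
    refine le_limsup_of_frequently_le (Eventually.frequently ?_) (by isBoundedDefault)
    have h1 : ∀ᶠ r : ℝ≥0 in 𝓝[>] 0, r < 1 :=
      mem_nhdsWithin_of_mem_nhds (Iio_mem_nhds one_pos)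
    filter_upwards [h1, self_mem_nhdsWithin] with r hr hr0
    refine EReal.div_nonneg ?_ ?_
    · rw [ENNReal.zero_le_log_iff]
      have : 1 ≤ Metric.externalCoveringNumber r A :=
        Order.one_le_iff_pos.2 (Metric.externalCoveringNumber_pos_iff.2 hA)
      exact_mod_cast ENat.toENNReal_le.2 this
    · have := Real.log_nonpos r.2 (by exact_mod_cast hr.le)
      exact_mod_cast neg_nonneg.2 this
  exact_mod_cast h0.trans h

lemma eventually_externalCoveringNumber_le {X : Type*} [PseudoEMetricSpace X] {A : Set X}
    {β : ℝ} (h : upperBoxDim A < (β : EReal)) :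
    ∀ᶠ r : ℝ≥0 in 𝓝[>] 0,
      (Metric.externalCoveringNumber r A : ℝ≥0∞) ≤ ENNReal.ofReal ((r : ℝ) ^ (-β)) := by
  have h1 : ∀ᶠ r : ℝ≥0 in 𝓝[>] 0, r < 1 :=
    mem_nhdsWithin_of_mem_nhds (Iio_mem_nhds one_pos)
  filter_upwards [eventually_lt_of_limsup_lt h (by isBoundedDefault), h1, self_mem_nhdsWithin]
    with r hr hr1 hr0
  have hr0' : (0 : ℝ) < r := by exact_mod_cast hr0
  have hlog : 0 < -Real.log (r : ℝ) := neg_pos.2 (Real.log_neg hr0' (by exact_mod_cast hr1))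
  rw [EReal.div_lt_iff (by exact_mod_cast hlog) (EReal.coe_ne_top _), ← EReal.coe_mul] at hr
  have h2 := EReal.exp_le_exp_iff.2 hr.le
  rw [ENNReal.exp_log, EReal.exp_coe] at h2
  refine h2.trans (le_of_eq ?_)
  rw [Real.rpow_def_of_pos hr0']
  ring_nf

/-- The exceptional null set depends on `s`, so `s` runs through the rationals. A law provides only
a.e. measurability, hence the measurable versions `ω'`, which agree with `ω` for all `n` at once off
a null set. -/
theorem ae_tsub_lowerRate_le_dimH_diff {Ω : Type*} [MeasurableSpace Ω] {P : Measure Ω}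
    [IsProbabilityMeasure P] {ω : ℕ+ → Ω → UnitAddCircle} (hind : iIndepFun ω P)
    (hlaw : ∀ n, HasLaw (ω n) (volume : Measure UnitAddCircle) P)
    {ℓ : ℕ+ → ℝ} (hanti : Antitone ℓ) (hmem : ∀ n, ℓ n ∈ Set.Ioo (0 : ℝ) 1)
    {A : Set UnitAddCircle} (hA : AnalyticSet A) :
    ∀ᵐ w ∂P, dimH A - lowerRate ℓ ≤ dimH (A \ uniformlyCovered ℓ (fun n => ω n w)) := by
  set ω' : ℕ+ → Ω → UnitAddCircle := fun n => (hlaw n).aemeasurable.mk (ω n) with hω'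
  have hae : ∀ n, ω n =ᵐ[P] ω' n := fun n => (hlaw n).aemeasurable.ae_eq_mk
  have hm : ∀ n, Measurable (ω' n) := fun n => (hlaw n).aemeasurable.measurable_mk
  have hlaw' : ∀ n, HasLaw (ω' n) (volume : Measure UnitAddCircle) P := fun n =>
    (hlaw n).congr (hae n).symm
  have hall : ∀ᵐ w ∂P, ∀ q : ℚ, 0 < Real.toNNReal q → lowerRate ℓ + Real.toNNReal q < dimH A →
      (Real.toNNReal q : ℝ≥0∞) ≤ dimH (A \ uniformlyCovered ℓ (fun n => ω' n w)) := by
    rw [ae_all_iff]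
    intro q
    by_cases h : 0 < Real.toNNReal q ∧ lowerRate ℓ + Real.toNNReal q < dimH A
    · filter_upwards [ae_le_dimH_diff_uniformlyCovered hm (hind.congr hae) hlaw' hanti hmem hA
        h.1 h.2] with w hw _ _ using hw
    · exact Eventually.of_forall fun w h1 h2 => absurd ⟨h1, h2⟩ h
  filter_upwards [hall, ae_all_iff.2 hae] with w hw hww
  rw [funext hww]
  refine le_of_forall_lt fun b hb => ?_
  obtain ⟨q, -, hbq, hq⟩ := ENNReal.lt_iff_exists_rat_btwn.1 hb
  exact hbq.trans_le (hw q (by exact_mod_cast pos_of_gt hbq) (lt_tsub_iff_left.1 hq))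

end UniformCovering

theorem theorem1
    {Ω : Type*} [MeasurableSpace Ω] (P : Measure Ω) [IsProbabilityMeasure P]
    (ℓ : ℕ+ → ℝ) (hℓ_anti : Antitone ℓ) (hℓ_mem : ∀ n, ℓ n ∈ Set.Ioo (0 : ℝ) 1)
    (ω : ℕ+ → Ω → UnitAddCircle) (hω_indep : iIndepFun ω P)
    (hω_unif : ∀ n, HasLaw (ω n) (volume : Measure UnitAddCircle) P) :
    (UniformCovering.lowerRate ℓ < 1 →
      ∀ A : Set UnitAddCircle, AnalyticSet A → UniformCovering.lowerRate ℓ < dimH A →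
        P {x | A ⊆ UniformCovering.uniformlyCovered ℓ (fun n => ω n x)} = 0 ∧
        ∀ᵐ x ∂P, dimH A - UniformCovering.lowerRate ℓ ≤
          dimH (A \ UniformCovering.uniformlyCovered ℓ (fun n => ω n x))) ∧
    (∀ (A : Set UnitAddCircle) (β : ℝ),
      (UniformCovering.upperBoxDim A ≤ (β : EReal) ∨
        ∀ᶠ r : ℝ≥0 in 𝓝[>] 0,
          (Metric.externalCoveringNumber r A : ℝ≥0∞) ≤ ENNReal.ofReal ((r : ℝ) ^ (-β))) →
      (∃ d ∈ Set.Ioo (0 : ℝ) 1,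
        Summable (fun n : ℕ+ => (1 / ℓ n) ^ β * Real.exp (-((n : ℝ) * d * ℓ n)))) →
      ∀ᵐ x ∂P, A ⊆ UniformCovering.uniformlyCovered ℓ (fun n => ω n x)) := by
  constructor
  · intro _ A hA hdim
    have hae := UniformCovering.ae_tsub_lowerRate_le_dimH_diff hω_indep hω_unif hℓ_anti hℓ_mem hA
    refine ⟨measure_mono_null (t := {x | ¬ dimH A - UniformCovering.lowerRate ℓ ≤
      dimH (A \ UniformCovering.uniformlyCovered ℓ (fun n => ω n x))})
      (fun x (hx : A ⊆ UniformCovering.uniformlyCovered ℓ (fun n => ω n x)) hle => ?_) hae, hae⟩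
    rw [Set.sdiff_eq_empty.2 hx, dimH_empty, nonpos_iff_eq_zero, tsub_eq_zero_iff_le] at hle
    exact absurd hdim (not_lt.2 hle)
  · rintro A β (hA | hA) ⟨d, ⟨hd0, hd1⟩, hsum⟩
    -- The empty set has box dimension `-∞`, which gives no sign for `β`; for nonempty `A` one gets
    -- `0 ≤ β`, as the exponent trade requires.
    · rcases A.eq_empty_or_nonempty with rfl | hne
      · exact Eventually.of_forall fun x => Set.empty_subset _
      obtain ⟨d', hd, hd'⟩ := exists_between hd1
      obtain ⟨β', hβ', hsum'⟩ := UniformCovering.exists_summable_of_summable hℓ_anti hℓ_mem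
        (UniformCovering.nonneg_of_upperBoxDim_le hne hA) hd0 hd hsum
      exact UniformCovering.ae_subset_uniformlyCovered_of_covering_le hω_indep hω_unif hℓ_mem
        (UniformCovering.eventually_externalCoveringNumber_le
          (hA.trans_lt (by exact_mod_cast hβ'))) (hd0.trans hd) hd' hsum'
    · exact UniformCovering.ae_subset_uniformlyCovered_of_covering_le hω_indep hω_unif hℓ_mem hA
        hd0 hd1 hsum
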